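/- For a sequence $p=(p_1,\dots,p_n)$ of integers with all $p_i\ge 2$, let $S_p=[p_1]\times\cdots\times[p_n]$, where $[k]=\{1,\dots,k\}$, and let $d$ denote the Hamming distance on $S_p$. Families $A,B\subseteq S_p$ form an $r$-cross-intersecting pair if $d(x,y)\le n-r$ for all $x\in A$, $y\in B$; such a pair is maximal if $|A|\cdot|B|$ is the largest possible among all $r$-cross-intersecting pairs in $S_p$. A coordinate $i\in[n]$ is irrelevant for $A$ if, whenever two elements of $S_p$ differ only in coordinate $i$ and $A$ contains one of them, it also contains the other; otherwise $i$ is relevant for $A$. The relevant coordinates of a pair $(A,B)$ are those that are relevant for $A$ or for $B$. A ball is a family of the form $\{x\in S_p : |\{i\in T : x_i\ne (x_0)_i\}|\le k\}$ with $T\subseteq[n]$, $x_0\in S_p$ and an integer $0\le k\le|T|$. Theorem. Let $1\le r\le n$ and let $p=(p_1,\dots,p_n)$ be a sequence of integers with $p_i\ge2$ for all $i$. 1. If there exists a maximal $r$-cross-intersecting pair in $S_p$ with at most $r+2$ relevant coordinates, then there exists a maximal $r$-cross-intersecting pair in $S_p$ with at most $r+2$ relevant coordinates that consists of two balls. 2.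 If $p_i>2$ for all $i\in[n]$ and $A,B\subseteq S_p$ form a maximal $r$-cross-intersecting pair with at most $r+3$ relevant coordinates, then $A$ and $B$ are balls. -/

import Mathlib

namespace CrossIntersecting

/-- The set `S_p = [p_1] × ⋯ × [p_n]` of vectors, with `[k]` modelled by `Fin k`. -/
abbrev Vec {n : ℕ} (p : Fin n → ℕ) : Type := ∀ i : Fin n, Fin (p i)

/-- A size vector: all entries are at least `2`. -/
def IsSizeVector {n : ℕ} (p : Fin n → ℕ) : Prop := ∀ i, 2 ≤ p i

/-- `x` and `y` are `r`-intersecting: their Hamming distance is at most `n - r`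
(written without truncated subtraction). -/
def RIntersecting {n : ℕ} {p : Fin n → ℕ} (r : ℕ) (x y : Vec p) : Prop :=
  hammingDist x y + r ≤ n

/-- `A` and `B` are `r`-cross-intersecting families. -/
def CrossInt {n : ℕ} {p : Fin n → ℕ} (r : ℕ) (A B : Finset (Vec p)) : Prop :=
  ∀ x ∈ A, ∀ y ∈ B, RIntersecting r x y

/-- `(A, B)` is a maximal `r`-cross-intersecting pair: it maximizes `|A| * |B|` among all
`r`-cross-intersecting pairs. -/
def IsMaximalPair {n : ℕ} {p : Fin n → ℕ} (r : ℕ) (A B : Finset (Vec p)) : Prop :=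
  CrossInt r A B ∧
    ∀ A' B' : Finset (Vec p), CrossInt r A' B' → A'.card * B'.card ≤ A.card * B.card

/-- Coordinate `i` is irrelevant for `A`: whenever two vectors differ only in coordinate `i`
and `A` contains one of them, it also contains the other. -/
def Irrelevant {n : ℕ} {p : Fin n → ℕ} (A : Finset (Vec p)) (i : Fin n) : Prop :=
  ∀ x y : Vec p, (∀ j, j ≠ i → x j = y j) → x ∈ A → y ∈ A

/-- Coordinate `i` is relevant for `A`. -/
def Relevant {n : ℕ} {p : Fin n → ℕ} (A : Finset (Vec p)) (i : Fin n) : Prop :=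
  ¬ Irrelevant A i

open Classical in
/-- The set of coordinates relevant for `A` or for `B`. -/
noncomputable def relevantCoords {n : ℕ} {p : Fin n → ℕ} (A B : Finset (Vec p)) :
    Finset (Fin n) :=
  Finset.univ.filter fun i => Relevant A i ∨ Relevant B i

/-- The Hamming ball of radius `k` around `x₀` in the coordinates `T`. -/
def hammingBall {n : ℕ} {p : Fin n → ℕ} (T : Finset (Fin n)) (x₀ : Vec p) (k : ℕ) :
    Finset (Vec p) :=
  Finset.univ.filter fun x => (T.filter fun i => x i ≠ x₀ i).card ≤ k

/-- `A` is a ball: a Hamming ball for some coordinate set `T`, center and radius `k ≤ |T|`. -/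
def IsBall {n : ℕ} {p : Fin n → ℕ} (A : Finset (Vec p)) : Prop :=
  ∃ (T : Finset (Fin n)) (x₀ : Vec p) (k : ℕ), k ≤ T.card ∧ A = hammingBall T x₀ k

end CrossIntersecting

/-! Shifting values in a coordinate towards a base vector `c` preserves sizes, cross-intersection
and irrelevance, and lowers the total distance of `A` from `c` unless `A` is fixed. Iterating yields
a maximal pair with `A` monotone. By maximality, membership then depends only on the support of a
vector (where it differs from `c`), so the problem becomes one about set families: a set weighs the
product of `p i - 1` over its points, and all cross unions must miss `r` points
(`IsMaximalPair.isOpt`). Irrelevant coordinates become free points, which can be deleted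
(`IsOpt.reduction`), leaving at most `r + 2` or `r + 3` points.

If the ground set exceeds `r` by at most two points, cross unions have at most two points and few
configurations remain. The only one that is not a pair of balls loses to one of two competitors
(`not_pair_of_singletons`). This settles the first claim.

For an excess of three and weights at least two, the main tool is `rare_or_freePoint`: each point is
free in both families, or its link is lighter than its deletion by a factor `w i ^ 2` in both.
Rarity excludes triples, unless the other family is trivial. What remains is two graphs in which
every edge of one meets every edge of the other. They cannot both have edges (`not_both_pairs`), and
the surviving pairs are balls.

The second claim concerns all maximal pairs, so shifts must be undone (`IsHammingPair.unshift`).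
Suppose a shifted pair consists of balls with enough room (`Spread`). In the original pair, all
vectors on the boundary of a ball must then use the same value in the shifted coordinate, since
otherwise two opposite vectors would be too far apart. So the original pair consists of balls too,
with at most the centre changed. The cases without room, radii `1, 1` and `1, 2` with `r = 1`, are
not optimal for weights at least two. -/

namespace CrossIntersecting

open Finset

/-! ### Weighted set families, optimal pairs, and the free-or-rare dichotomy. -/

section Weight

variable {α : Type*}

/-- The total weight of a set family, a set weighing the product of the weights of its points. -/
def wt (w : α → ℕ) (𝒜 : Finset (Finset α)) : ℕ := ∑ F ∈ 𝒜, ∏ i ∈ F, w i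

section

variable {w : α → ℕ} {𝒜 ℬ : Finset (Finset α)}

lemma wt_mono (h : 𝒜 ⊆ ℬ) : wt w 𝒜 ≤ wt w ℬ :=
  sum_le_sum_of_subset h

@[simp] lemma wt_empty : wt w ∅ = 0 := rfl

lemma wt_singleton (F : Finset α) : wt w {F} = ∏ i ∈ F, w i := sum_singleton _ _

lemma wt_powerset (S : Finset α) : wt w S.powerset = ∏ i ∈ S, (1 + w i) := by
  rw [prod_one_add]; rfl

lemma prod_weight_pos (hw : ∀ i, 1 ≤ w i) (F : Finset α) : 0 < ∏ i ∈ F, w i :=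
  prod_pos fun i _ => hw i

/-- Subsets of `S` with at most one point. -/
def smallSets (S : Finset α) : Finset (Finset α) := S.powerset.filter fun F => #F ≤ 1

lemma mem_smallSets {S F : Finset α} : F ∈ smallSets S ↔ F ⊆ S ∧ #F ≤ 1 := by
  simp [smallSets]

lemma mem_smallSets' {S F : Finset α} : F ∈ smallSets S ↔ F = ∅ ∨ ∃ s ∈ S, F = {s} := by
  rw [mem_smallSets]
  constructor
  · rintro ⟨h, hc⟩
    rcases F.eq_empty_or_nonempty with rfl | hne
    · exact Or.inl rfl
    · obtain ⟨s, rfl⟩ := card_eq_one.1 (le_antisymm hc hne.card_pos)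
      exact Or.inr ⟨s, by simpa using h, rfl⟩
  · rintro (rfl | ⟨s, hs, rfl⟩) <;> simp [*]

end


variable [DecidableEq α] {w : α → ℕ} {𝒜 ℬ : Finset (Finset α)} {T : Finset α} {r : ℕ} {i j : α}

lemma wt_insert {F : Finset α} (h : F ∉ 𝒜) : wt w (insert F 𝒜) = ∏ i ∈ F, w i + wt w 𝒜 :=
  sum_insert h

lemma wt_insert_le (F : Finset α) : wt w (insert F 𝒜) ≤ ∏ i ∈ F, w i + wt w 𝒜 := by
  by_cases h : F ∈ 𝒜
  · rw [insert_eq_of_mem h]; omega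
  · rw [wt_insert h]

lemma wt_union_le : wt w (𝒜 ∪ ℬ) ≤ wt w 𝒜 + wt w ℬ := by
  unfold wt
  rw [← sum_union_inter]
  omega

lemma eq_of_subset_of_wt_le (hw : ∀ i, 1 ≤ w i) (h : 𝒜 ⊆ ℬ) (h' : wt w ℬ ≤ wt w 𝒜) : 𝒜 = ℬ := by
  by_contra hne
  obtain ⟨F, hF, hF'⟩ := exists_of_ssubset (h.ssubset_of_ne hne)
  have := wt_mono (w := w) (insert_subset hF h)
  rw [wt_insert hF'] at this
  have := prod_weight_pos hw F
  omega

lemma wt_split (i : α) (𝒜 : Finset (Finset α)) :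
    wt w 𝒜 = wt w (𝒜.nonMemberSubfamily i) + w i * wt w (𝒜.memberSubfamily i) := by
  unfold wt nonMemberSubfamily memberSubfamily
  rw [sum_image, mul_sum, ← sum_filter_add_sum_filter_not 𝒜 (fun s => i ∉ s)]
  · simp only [not_not]
    congr 1
    refine sum_congr rfl fun F hF => ?_
    exact (mul_prod_erase F w (mem_filter.1 hF).2).symm
  · intro s hs t ht h
    have hs := (mem_filter.1 hs).2
    have ht := (mem_filter.1 ht).2
    rw [← insert_erase hs, ← insert_erase ht]
    exact congrArg _ h

lemma wt_smallSets (S : Finset α) : wt w (smallSets S) = 1 + ∑ i ∈ S, w i := by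
  have : smallSets S = insert ∅ (S.image fun i => {i}) := by
    ext F
    rw [mem_smallSets', mem_insert, mem_image]
    simp only [eq_comm]
  rw [this, wt_insert (by simp), wt, sum_image (by intro a _ b _ h; simpa using h)]
  simp

lemma wt_image_pair_le (j : α) (S : Finset α) (hj : j ∉ S) :
    wt w (S.image fun m => {j, m}) ≤ w j * ∑ m ∈ S, w m := by
  unfold wt
  rw [mul_sum]
  refine (sum_image_le_of_nonneg (fun _ _ => Nat.zero_le _)).trans (sum_le_sum fun m hm => ?_)
  rw [prod_pair]
  rintro rfl
  exact hj hm

/-- Both copies, without and with the point `i`, of each member of the family. -/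
def double (i : α) (𝒜 : Finset (Finset α)) : Finset (Finset α) := 𝒜 ∪ 𝒜.image (insert i)

lemma wt_double (h : ∀ F ∈ 𝒜, i ∉ F) : wt w (double i 𝒜) = (1 + w i) * wt w 𝒜 := by
  rw [wt_split i]
  have h0 : (double i 𝒜).nonMemberSubfamily i = 𝒜 := by
    ext F
    simp only [double, mem_nonMemberSubfamily, mem_union, mem_image]
    constructor
    · rintro ⟨hF | ⟨G, _, rfl⟩, hi⟩
      · exact hF
      · simp at hi
    · exact fun hF => ⟨Or.inl hF, h F hF⟩
  have h1 : (double i 𝒜).memberSubfamily i = 𝒜 := by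
    ext F
    simp only [double, mem_memberSubfamily, mem_union, mem_image]
    constructor
    · rintro ⟨hF | ⟨G, hG, hGF⟩, hi⟩
      · exact absurd (mem_insert_self i F) (h _ hF)
      · rwa [← erase_insert hi, ← hGF, erase_insert (h G hG)]
    · exact fun hF => ⟨Or.inr ⟨F, hF, rfl⟩, h F hF⟩
  rw [h0, h1]; ring

/-- `(𝒜, ℬ)` maximizes the product of weights among pairs of families of subsets of `T` all of
whose cross unions miss at least `r` points of `T`. -/
structure IsOpt (w : α → ℕ) (T : Finset α) (r : ℕ) (𝒜 ℬ : Finset (Finset α)) : Prop where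
  subset_left : ∀ F ∈ 𝒜, F ⊆ T
  subset_right : ∀ F ∈ ℬ, F ⊆ T
  cross : ∀ F ∈ 𝒜, ∀ G ∈ ℬ, #(F ∪ G) + r ≤ #T
  max : ∀ 𝒜' ℬ' : Finset (Finset α), (∀ F ∈ 𝒜', F ⊆ T) → (∀ F ∈ ℬ', F ⊆ T) →
    (∀ F ∈ 𝒜', ∀ G ∈ ℬ', #(F ∪ G) + r ≤ #T) → wt w 𝒜' * wt w ℬ' ≤ wt w 𝒜 * wt w ℬ

namespace IsOpt

lemma symm (h : IsOpt w T r 𝒜 ℬ) : IsOpt w T r ℬ 𝒜 where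
  subset_left := h.subset_right
  subset_right := h.subset_left
  cross F hF G hG := by rw [union_comm]; exact h.cross G hG F hF
  max 𝒜' ℬ' h1 h2 h3 := by
    rw [mul_comm, mul_comm (wt w ℬ)]
    exact h.max ℬ' 𝒜' h2 h1 fun F hF G hG => by rw [union_comm]; exact h3 G hG F hF

lemma wt_pos_mul (h : IsOpt w T r 𝒜 ℬ) (hr : r ≤ #T) : 0 < wt w 𝒜 * wt w ℬ := by
  have := h.max {∅} {∅} (by simp) (by simp) (by simpa using hr)
  simp only [wt_singleton, prod_empty] at this
  omega

lemma wt_left_pos (h : IsOpt w T r 𝒜 ℬ) (hr : r ≤ #T) : 0 < wt w 𝒜 :=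
  pos_of_mul_pos_left (h.wt_pos_mul hr) (Nat.zero_le _)

lemma wt_right_pos (h : IsOpt w T r 𝒜 ℬ) (hr : r ≤ #T) : 0 < wt w ℬ :=
  h.symm.wt_left_pos hr

/-- Optimal families are saturated: adding a compatible set would increase one weight while the
other is positive. -/
lemma mem_of_forall (h : IsOpt w T r 𝒜 ℬ) (hw : ∀ i, 1 ≤ w i) (hr : r ≤ #T) {F : Finset α}
    (hF : F ⊆ T) (hc : ∀ G ∈ ℬ, #(F ∪ G) + r ≤ #T) : F ∈ 𝒜 := by
  by_contra hn
  have := h.max (insert F 𝒜) ℬ (by simpa using ⟨hF, h.subset_left⟩) h.subset_right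
    (by simpa using ⟨hc, h.cross⟩)
  rw [wt_insert hn] at this
  have h1 := prod_weight_pos hw F
  have h2 := h.wt_right_pos hr
  nlinarith

lemma mem_of_subset (h : IsOpt w T r 𝒜 ℬ) (hw : ∀ i, 1 ≤ w i) (hr : r ≤ #T) {F F' : Finset α}
    (hF : F ∈ 𝒜) (hF' : F' ⊆ F) : F' ∈ 𝒜 :=
  h.mem_of_forall hw hr (hF'.trans (h.subset_left F hF)) fun G hG =>
    le_trans (Nat.add_le_add_right (card_le_card (union_subset_union_left hF')) r)
      (h.cross F hF G hG)

lemma empty_mem (h : IsOpt w T r 𝒜 ℬ) (hw : ∀ i, 1 ≤ w i) (hr : r ≤ #T) : ∅ ∈ 𝒜 := by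
  have : 𝒜.Nonempty := by
    rw [nonempty_iff_ne_empty]
    rintro rfl
    simpa using h.wt_left_pos hr
  obtain ⟨F, hF⟩ := this
  exact h.mem_of_subset hw hr hF (empty_subset _)

end IsOpt

/-- Membership in `𝒜` does not depend on the point `i`. -/
def FreePoint (𝒜 : Finset (Finset α)) (i : α) : Prop := ∀ F, insert i F ∈ 𝒜 ↔ F.erase i ∈ 𝒜

lemma FreePoint.mem_iff_erase (h : FreePoint 𝒜 i) (F : Finset α) : F ∈ 𝒜 ↔ F.erase i ∈ 𝒜 := by
  by_cases hi : i ∈ F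
  · rw [← h F, insert_eq_of_mem hi]
  · rw [erase_eq_of_notMem hi]

lemma mem_double_nonMemberSubfamily {F : Finset α}
    (hF : F ∈ double i (𝒜.nonMemberSubfamily i)) : F.erase i ∈ 𝒜 := by
  simp only [double, mem_union, mem_image, mem_nonMemberSubfamily] at hF
  rcases hF with ⟨h, hi⟩ | ⟨G, ⟨h, hi⟩, rfl⟩
  · rwa [erase_eq_of_notMem hi]
  · rwa [erase_insert hi]

lemma mem_double_memberSubfamily {F : Finset α}
    (hF : F ∈ double i (𝒜.memberSubfamily i)) : insert i F ∈ 𝒜 := by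
  simp only [double, mem_union, mem_image, mem_memberSubfamily] at hF
  rcases hF with ⟨h, hi⟩ | ⟨G, ⟨h, hi⟩, rfl⟩
  · exact h
  · simpa using h

lemma union_subset_erase_union_insert (F G : Finset α) (i : α) :
    F ∪ G ⊆ F.erase i ∪ insert i G := by
  intro x
  simp only [mem_union, mem_erase, mem_insert]
  tauto

/-- The deletion of `i` in one family and the link of `i` in the other, both made independent of
`i`, still form an admissible pair: the point erased from one set is present in its partner. -/
lemma IsOpt.double_mul_le (h : IsOpt w T r 𝒜 ℬ) (hi : i ∈ T) :
    (1 + w i) ^ 2 * (wt w (𝒜.nonMemberSubfamily i) * wt w (ℬ.memberSubfamily i)) ≤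
      wt w 𝒜 * wt w ℬ := by
  have := h.max (double i (𝒜.nonMemberSubfamily i)) (double i (ℬ.memberSubfamily i))
    (fun F hF => by
      have := h.subset_left _ (mem_double_nonMemberSubfamily hF)
      intro x hx
      by_cases hxi : x = i
      · rwa [hxi]
      · exact this (mem_erase.2 ⟨hxi, hx⟩))
    (fun F hF => (subset_insert i F).trans (h.subset_right _ (mem_double_memberSubfamily hF)))
    (fun F hF G hG => le_trans
      (Nat.add_le_add_right (card_le_card (union_subset_erase_union_insert F G i)) r)
      (h.cross _ (mem_double_nonMemberSubfamily hF) _ (mem_double_memberSubfamily hG)))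
  rw [wt_double (by simp), wt_double (by simp)] at this
  linarith [this, show (1 + w i) ^ 2 * (wt w (𝒜.nonMemberSubfamily i) *
    wt w (ℬ.memberSubfamily i)) = (1 + w i) * wt w (𝒜.nonMemberSubfamily i) *
      ((1 + w i) * wt w (ℬ.memberSubfamily i)) by ring]

/-- Here `a0`, `a1` are the weights of deletion and link in the family with the larger
link-to-deletion ratio. Inserting `hle` into `h2` and cancelling `b0` leaves `0 ≤ (a0 - a1) * (a0 -
w ^ 2 * a1)`. If the first factor is positive, the bound on `a1` passes to `b1` through the ratios;
if it vanishes, `h2` forces `b1 = b0`. -/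
lemma ratio_dichotomy {w a0 a1 b0 b1 : ℤ} (hw : 1 ≤ w) (ha1 : 0 ≤ a1) (hb0 : 0 < b0)
    (ha : a1 ≤ a0) (hb : b1 ≤ b0)
    (h2 : (1 + w) ^ 2 * (a1 * b0) ≤ (a0 + w * a1) * (b0 + w * b1)) (ha0 : 0 < a0)
    (hle : b1 * a0 ≤ a1 * b0) :
    (w ^ 2 * a1 ≤ a0 ∧ w ^ 2 * b1 ≤ b0) ∨ (a1 = a0 ∧ b1 = b0) := by
  have key : (a0 + w * a1) * (b0 + w * b1) * a0 ≤ (a0 + w * a1) * ((a0 + w * a1) * b0) := by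
    have : (b0 + w * b1) * a0 ≤ (a0 + w * a1) * b0 := by nlinarith
    have h0 : 0 ≤ a0 + w * a1 := by positivity
    nlinarith [mul_le_mul_of_nonneg_left this h0]
  have key2 : 0 ≤ b0 * ((a0 - a1) * (a0 - w ^ 2 * a1)) := by
    have := mul_le_mul_of_nonneg_right h2 ha0.le
    nlinarith
  have key3 : 0 ≤ (a0 - a1) * (a0 - w ^ 2 * a1) := nonneg_of_mul_nonneg_right key2 hb0
  rcases ha.eq_or_lt with he | hlt
  · right
    refine ⟨he, le_antisymm hb ?_⟩
    subst he
    have h3 : (1 + w) * b0 ≤ b0 + w * b1 := by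
      have : (a1 * (1 + w)) * ((1 + w) * b0) ≤ (a1 * (1 + w)) * (b0 + w * b1) := by nlinarith
      exact le_of_mul_le_mul_left this (by positivity)
    have : w * b0 ≤ w * b1 := by linarith
    exact le_of_mul_le_mul_left this (by linarith)
  · left
    have h3 : w ^ 2 * a1 ≤ a0 := by
      have := nonneg_of_mul_nonneg_right key3 (by linarith)
      linarith
    refine ⟨h3, ?_⟩
    have : a0 * (w ^ 2 * b1) ≤ a0 * b0 := by
      have h4 := mul_le_mul_of_nonneg_left hle (sq_nonneg w)
      have h5 := mul_le_mul_of_nonneg_right h3 hb0.le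
      nlinarith
    exact le_of_mul_le_mul_left this ha0

namespace IsOpt

lemma memberSubfamily_subset (h : IsOpt w T r 𝒜 ℬ) (hw : ∀ i, 1 ≤ w i) (hr : r ≤ #T) (i : α) :
    𝒜.memberSubfamily i ⊆ 𝒜.nonMemberSubfamily i := fun F hF => by
  rw [mem_memberSubfamily] at hF
  exact mem_nonMemberSubfamily.2 ⟨h.mem_of_subset hw hr hF.1 (subset_insert _ _), hF.2⟩

lemma nonMemberSubfamily_pos (h : IsOpt w T r 𝒜 ℬ) (hw : ∀ i, 1 ≤ w i) (hr : r ≤ #T) (i : α) :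
    0 < wt w (𝒜.nonMemberSubfamily i) := by
  have : ({∅} : Finset (Finset α)) ⊆ 𝒜.nonMemberSubfamily i := by
    simpa using h.empty_mem hw hr
  have := wt_mono (w := w) this
  simp only [wt_singleton, prod_empty] at this
  omega

lemma freePoint_of_wt_eq (h : IsOpt w T r 𝒜 ℬ) (hw : ∀ i, 1 ≤ w i) (hr : r ≤ #T)
    (he : wt w (𝒜.memberSubfamily i) = wt w (𝒜.nonMemberSubfamily i)) : FreePoint 𝒜 i := by
  have := eq_of_subset_of_wt_le hw (h.memberSubfamily_subset hw hr i) he.ge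
  intro F
  have h1 := congrArg (fun 𝒞 => F.erase i ∈ 𝒞) this
  have h2 : insert i (F.erase i) = insert i F := by grind
  simp only [mem_memberSubfamily, mem_nonMemberSubfamily, notMem_erase, not_false_eq_true,
    and_true, h2] at h1
  exact h1.to_iff

/-- A point is either free in both families of an optimal pair, or it is rare in both. -/
lemma rare_or_freePoint (h : IsOpt w T r 𝒜 ℬ) (hw : ∀ i, 1 ≤ w i) (hr : r ≤ #T) (hi : i ∈ T) :
    (w i ^ 2 * wt w (𝒜.memberSubfamily i) ≤ wt w (𝒜.nonMemberSubfamily i) ∧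
      w i ^ 2 * wt w (ℬ.memberSubfamily i) ≤ wt w (ℬ.nonMemberSubfamily i)) ∨
    (FreePoint 𝒜 i ∧ FreePoint ℬ i) := by
  have h1 := h.double_mul_le hi
  have h2 := h.symm.double_mul_le hi
  have ha := wt_mono (w := w) (h.memberSubfamily_subset hw hr i)
  have hb := wt_mono (w := w) (h.symm.memberSubfamily_subset hw hr i)
  have ha0 := h.nonMemberSubfamily_pos hw hr i
  have hb0 := h.symm.nonMemberSubfamily_pos hw hr i
  rw [wt_split i 𝒜, wt_split i ℬ] at h1 h2
  have fa := h.freePoint_of_wt_eq (i := i) hw hr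
  have fb := h.symm.freePoint_of_wt_eq (i := i) hw hr
  have hwi := hw i
  generalize wt w (𝒜.nonMemberSubfamily i) = a0 at *
  generalize wt w (ℬ.nonMemberSubfamily i) = b0 at *
  generalize wt w (𝒜.memberSubfamily i) = a1 at *
  generalize wt w (ℬ.memberSubfamily i) = b1 at *
  generalize w i = v at *
  -- The family with the larger ratio of link to deletion takes the role of `a`.
  rcases le_total (b1 * a0) (a1 * b0) with hle | hle
  · have := ratio_dichotomy (w := v) (a0 := a0) (a1 := a1) (b0 := b0) (b1 := b1)
      (by exact_mod_cast hwi) (by positivity) (by exact_mod_cast hb0)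
      (by exact_mod_cast ha) (by exact_mod_cast hb) (by rw [mul_comm (a1 : ℤ)]; zify at h2; linarith)
      (by exact_mod_cast ha0) (by exact_mod_cast hle)
    norm_cast at this
    tauto
  · have := ratio_dichotomy (w := v) (a0 := b0) (a1 := b1) (b0 := a0) (b1 := a1)
      (by exact_mod_cast hwi) (by positivity) (by exact_mod_cast ha0)
      (by exact_mod_cast hb) (by exact_mod_cast ha) (by rw [mul_comm (b1 : ℤ)]; zify at h1; linarith)
      (by exact_mod_cast hb0) (by exact_mod_cast hle)
    norm_cast at this
    tauto

/-- A free point may be removed from the ground set. -/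
lemma erase_freePoint (h : IsOpt w T r 𝒜 ℬ) (hr : r ≤ #T) (hi : i ∈ T) (fa : FreePoint 𝒜 i)
    (fb : FreePoint ℬ i) (hw : ∀ i, 1 ≤ w i) :
    IsOpt w (T.erase i) r (𝒜.nonMemberSubfamily i) (ℬ.nonMemberSubfamily i) ∧
      r ≤ #(T.erase i) := by
  have hc : #(T.erase i) + 1 = #T := card_erase_add_one hi
  have hmem : ∀ 𝒞 : Finset (Finset α), FreePoint 𝒞 i →
      wt w 𝒞 = (1 + w i) * wt w (𝒞.nonMemberSubfamily i) := by
    intro 𝒞 hf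
    have : 𝒞.memberSubfamily i = 𝒞.nonMemberSubfamily i := by
      ext F
      rw [mem_memberSubfamily, mem_nonMemberSubfamily]
      refine and_congr_left fun hF => ?_
      rw [hf, erase_eq_of_notMem hF]
    rw [wt_split i, this]; ring
  have hcross : ∀ F ∈ 𝒜.nonMemberSubfamily i, ∀ G ∈ ℬ.nonMemberSubfamily i,
      #(F ∪ G) + r ≤ #(T.erase i) := by
    intro F hF G hG
    rw [mem_nonMemberSubfamily] at hF hG
    -- Adding the free point to one set uses up a point of the union, which pays for removing `i`
    -- from `T`.
    have h1 : insert i F ∈ 𝒜 := by rw [fa, erase_eq_of_notMem hF.2]; exact hF.1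
    have h2 := h.cross _ h1 _ hG.1
    rw [insert_union, card_insert_of_notMem (by simp [hF.2, hG.2])] at h2
    omega
  refine ⟨⟨?_, ?_, hcross, ?_⟩, ?_⟩
  · intro F hF
    rw [mem_nonMemberSubfamily] at hF
    exact subset_erase.2 ⟨h.subset_left F hF.1, hF.2⟩
  · intro F hF
    rw [mem_nonMemberSubfamily] at hF
    exact subset_erase.2 ⟨h.subset_right F hF.1, hF.2⟩
  · intro 𝒜' ℬ' h1 h2 h3
    have n1 : ∀ F ∈ 𝒜', i ∉ F := fun F hF hiF => by simpa using h1 F hF hiF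
    have n2 : ∀ F ∈ ℬ', i ∉ F := fun F hF hiF => by simpa using h2 F hF hiF
    have hd : ∀ 𝒞 : Finset (Finset α), (∀ F ∈ 𝒞, F ⊆ T.erase i) → ∀ F ∈ double i 𝒞,
        ∃ G ∈ 𝒞, F ⊆ insert i G := by
      intro 𝒞 _ F hF
      simp only [double, mem_union, mem_image] at hF
      rcases hF with hF | ⟨G, hG, rfl⟩
      · exact ⟨F, hF, subset_insert _ _⟩
      · exact ⟨G, hG, Subset.rfl⟩
    have hs : ∀ 𝒞 : Finset (Finset α), (∀ F ∈ 𝒞, F ⊆ T.erase i) → ∀ F ∈ double i 𝒞, F ⊆ T := by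
      intro 𝒞 h𝒞 F hF
      obtain ⟨G, hG, hFG⟩ := hd 𝒞 h𝒞 F hF
      exact hFG.trans (insert_subset hi ((h𝒞 G hG).trans (erase_subset _ _)))
    have := h.max (double i 𝒜') (double i ℬ') (hs _ h1) (hs _ h2) (by
      intro F hF G hG
      obtain ⟨F', hF', hFF⟩ := hd _ h1 F hF
      obtain ⟨G', hG', hGG⟩ := hd _ h2 G hG
      have h4 := h3 F' hF' G' hG'
      have h5 : #(F ∪ G) ≤ #(insert i (F' ∪ G')) := card_le_card (by
        intro x hx
        rcases mem_union.1 hx with hx | hx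
        · have := hFF hx
          simp only [mem_insert, mem_union] at this ⊢; tauto
        · have := hGG hx
          simp only [mem_insert, mem_union] at this ⊢; tauto)
      have h6 := card_insert_le i (F' ∪ G')
      omega)
    rw [wt_double n1, wt_double n2, hmem 𝒜 fa, hmem ℬ fb] at this
    refine le_of_mul_le_mul_left (a := (1 + w i) * (1 + w i)) ?_ (by positivity)
    linarith
  · have := hcross ∅ (by simpa using h.empty_mem hw hr) ∅ (by simpa using h.symm.empty_mem hw hr)
    simp at this
    omega

end IsOpt

end Weight

/-! ### Pairs of balls, and optimal pairs with at most two points of slack. -/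

section BallPair

variable {α : Type*} [DecidableEq α] {w : α → ℕ} {𝒜 ℬ : Finset (Finset α)} {T U : Finset α}
  {r k l : ℕ} {i j : α}

/-- Subsets of `T` with at most `k` points in `U`. -/
def setBall (T U : Finset α) (k : ℕ) : Finset (Finset α) := T.powerset.filter fun F => #(F ∩ U) ≤ k

lemma mem_setBall {F : Finset α} : F ∈ setBall T U k ↔ F ⊆ T ∧ #(F ∩ U) ≤ k := by
  simp [setBall]

/-- `𝒜` and `ℬ` consist of the subsets of `T` with at most `k`, respectively `l`, points in `U`,
where the radii are as large as cross unions missing `r` points allow. -/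
structure IsBallPair (T U : Finset α) (r k l : ℕ) (𝒜 ℬ : Finset (Finset α)) : Prop where
  subset : U ⊆ T
  card : k + l + r = #U
  left : 𝒜 = setBall T U k
  right : ℬ = setBall T U l

lemma IsBallPair.symm (h : IsBallPair T U r k l 𝒜 ℬ) : IsBallPair T U r l k ℬ 𝒜 :=
  ⟨h.subset, by rw [add_comm l]; exact h.card, h.right, h.left⟩

lemma subset_of_card_union_le {F G : Finset α} (h : #(F ∪ G) ≤ #G) : F ⊆ G := by
  rw [eq_of_subset_of_card_le subset_union_right h]
  exact subset_union_left

lemma eq_of_subset_pair {F : Finset α} (h : F ⊆ {i, j}) :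
    F = ∅ ∨ F = {i} ∨ F = {j} ∨ F = {i, j} := by
  rw [← coe_subset, coe_pair, Set.subset_pair_iff_eq] at h
  exact_mod_cast h

lemma card_union_add_le_of_setBall (hU : U ⊆ T) (hc : k + l + r = #U) {F G : Finset α}
    (hF : F ∈ setBall T U k) (hG : G ∈ setBall T U l) : #(F ∪ G) + r ≤ #T := by
  rw [mem_setBall] at hF hG
  have h1 : F ∪ G ⊆ (T \ U) ∪ ((F ∩ U) ∪ (G ∩ U)) := by
    intro x hx
    simp only [mem_union, mem_sdiff, mem_inter] at hx ⊢
    have := @hF.1 x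
    have := @hG.1 x
    tauto
  have h2 := card_le_card h1
  have h3 := card_union_le (T \ U) ((F ∩ U) ∪ (G ∩ U))
  have h4 := card_union_le (F ∩ U) (G ∩ U)
  have h5 := card_sdiff_add_card_eq_card hU
  omega

namespace IsOpt

/-- The two balls are themselves an admissible pair, so optimal families contained in them must fill
them. -/
lemma isBallPair_of_subset (h : IsOpt w T r 𝒜 ℬ) (hw : ∀ i, 1 ≤ w i) (hr : r ≤ #T) (hU : U ⊆ T)
    (hc : k + l + r = #U) (h𝒜 : ∀ F ∈ 𝒜, #(F ∩ U) ≤ k) (hℬ : ∀ F ∈ ℬ, #(F ∩ U) ≤ l) :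
    IsBallPair T U r k l 𝒜 ℬ := by
  have hA : 𝒜 ⊆ setBall T U k := fun F hF => mem_setBall.2 ⟨h.subset_left F hF, h𝒜 F hF⟩
  have hB : ℬ ⊆ setBall T U l := fun F hF => mem_setBall.2 ⟨h.subset_right F hF, hℬ F hF⟩
  have hm := h.max (setBall T U k) (setBall T U l) (fun F hF => (mem_setBall.1 hF).1)
    (fun F hF => (mem_setBall.1 hF).1)
    (fun F hF G hG => card_union_add_le_of_setBall hU hc hF hG)
  have hA' := wt_mono (w := w) hA
  have hB' := wt_mono (w := w) hB
  have pA := h.wt_left_pos hr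
  have pB := h.wt_right_pos hr
  refine ⟨hU, hc, eq_of_subset_of_wt_le hw hA ?_, eq_of_subset_of_wt_le hw hB ?_⟩
  · by_contra hlt
    nlinarith
  · by_contra hlt
    nlinarith

lemma isBallPair_of_trivial (h : IsOpt w T r 𝒜 ℬ) (hw : ∀ i, 1 ≤ w i) (hr : r ≤ #T)
    (hℬ : ∀ G ∈ ℬ, G = ∅) : IsBallPair T T r (#T - r) 0 𝒜 ℬ := by
  refine h.isBallPair_of_subset hw hr Subset.rfl (by omega) (fun F hF => ?_) fun G hG => ?_
  · have := h.cross F hF ∅ (h.symm.empty_mem hw hr)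
    rw [union_empty] at this
    have := card_le_card (inter_subset_left (s₁ := F) (s₂ := T))
    omega
  · simp [hℬ G hG]

/-- The comparison with the power set of `S`, where `S` misses `r` points. -/
lemma powerset_le (h : IsOpt w T r 𝒜 ℬ) {S : Finset α} (hS : S ⊆ T) (hc : #S + r ≤ #T) :
    (∏ i ∈ S, (1 + w i)) ^ 2 ≤ wt w 𝒜 * wt w ℬ := by
  rw [sq, ← wt_powerset]
  refine h.max _ _ (fun F hF => (mem_powerset.1 hF).trans hS)
    (fun F hF => (mem_powerset.1 hF).trans hS) fun F hF G hG => ?_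
  have := card_le_card (union_subset (mem_powerset.1 hF) (mem_powerset.1 hG))
  omega

/-- The configuration is squeezed between two competitors: both families equal to the power set of
`{i, j}`, or both equal to the sets of at most one point. -/
lemma not_pair_of_singletons (h : IsOpt w T r 𝒜 ℬ) (hw : ∀ i, 1 ≤ w i) (hd : #T = r + 2)
    (hij : i ≠ j) (hi : {i} ∈ ℬ) (hj : {j} ∈ ℬ)
    (hℬ : ∀ G ∈ ℬ, G = ∅ ∨ G = {i} ∨ G = {j}) : False := by
  have hiT : i ∈ T := by simpa using h.subset_right _ hi
  have hjT : j ∈ T := by simpa using h.subset_right _ hj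
  have hA : 𝒜 ⊆ insert {i, j} (smallSets T) := by
    intro F hF
    rw [mem_insert, mem_smallSets]
    by_cases hc : #F ≤ 1
    · exact Or.inr ⟨h.subset_left F hF, hc⟩
    · left
      have h1 := h.cross F hF _ hi
      have h2 := h.cross F hF _ hj
      have i1 : {i} ⊆ F := subset_of_card_union_le (by rw [union_comm]; omega)
      have i2 : {j} ⊆ F := subset_of_card_union_le (by rw [union_comm]; omega)
      have h3 : #F ≤ #({i, j} : Finset α) := by
        rw [card_pair hij]
        have := card_le_card (subset_union_left (s₁ := F) (s₂ := {i}))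
        omega
      exact (eq_of_subset_of_card_le (by
        rw [insert_subset_iff]; exact ⟨by simpa using i1, i2⟩) h3).symm
  have hB : ℬ ⊆ smallSets {i, j} := by
    intro G hG
    rw [mem_smallSets']
    rcases hℬ G hG with rfl | rfl | rfl <;> simp
  have hA' := (wt_mono (w := w) hA).trans (wt_insert_le _)
  have hB' := wt_mono (w := w) hB
  rw [wt_smallSets, prod_pair hij] at hA'
  rw [wt_smallSets, sum_pair hij] at hB'
  have m1 := h.powerset_le (S := {i, j}) (by simp [insert_subset_iff, hiT, hjT])
    (by rw [card_pair hij]; omega)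
  rw [prod_pair hij] at m1
  have m2 := h.max (smallSets T) (smallSets T) (fun F hF => (mem_smallSets.1 hF).1)
    (fun F hF => (mem_smallSets.1 hF).1) (fun F hF G hG => by
      have := card_union_le F G
      have := (mem_smallSets.1 hF).2
      have := (mem_smallSets.1 hG).2
      omega)
  rw [wt_smallSets] at m2
  have hm := Nat.mul_le_mul hA' hB'
  obtain ⟨s, hs⟩ : ∃ s, ∑ x ∈ T, w x = w i + w j + s := by
    have := sum_le_sum_of_subset (f := w) (show {i, j} ⊆ T by
      simp [insert_subset_iff, hiT, hjT])
    rw [sum_pair hij] at this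
    exact ⟨_, (Nat.add_sub_of_le this).symm⟩
  rw [hs] at hm m2
  have h1 := m1.trans hm
  have h2 := m2.trans hm
  have pi := hw i
  have pj := hw j
  generalize w i = a at *
  generalize w j = b at *
  -- With `s` the weight of the points outside `{i, j}`, the first competitor forces `a * b < s`,
  -- the second `s ≤ a * b`.
  have q1 : (1 + a + b + a * b) * (a * b) ≤ (1 + a + b) * s := by nlinarith
  have q2 : (1 + a + b) * s + s * s ≤ (1 + a + b) * (a * b) := by nlinarith
  have pab : 0 < a * b := by positivity
  nlinarith

/-- Optimal pairs with at most two points of slack are pairs of balls. -/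
lemma exists_isBallPair (h : IsOpt w T r 𝒜 ℬ) (hw : ∀ i, 1 ≤ w i) (hr : r ≤ #T)
    (hd : #T ≤ r + 2) : ∃ U k l, IsBallPair T U r k l 𝒜 ℬ := by
  by_cases tb : ∀ G ∈ ℬ, G = ∅
  · exact ⟨_, _, _, h.isBallPair_of_trivial hw hr tb⟩
  by_cases ta : ∀ G ∈ 𝒜, G = ∅
  · exact ⟨_, _, _, (h.symm.isBallPair_of_trivial hw hr ta).symm⟩
  push Not at ta tb
  obtain ⟨F, hF, F0⟩ := ta
  obtain ⟨G, hG, G0⟩ := tb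
  obtain ⟨i, hi⟩ := F0
  obtain ⟨j, hj⟩ := G0
  have hF1 := h.mem_of_subset hw hr hF (singleton_subset_iff.2 hi)
  have hG1 := h.symm.mem_of_subset hw hr hG (singleton_subset_iff.2 hj)
  have hiT : i ∈ T := h.subset_left F hF hi
  have hjT : j ∈ T := h.subset_right G hG hj
  clear hF hG hi hj F G
  have hc1 := h.cross _ hF1 _ hG1
  have hc2 : 0 < #({i} ∪ {j} : Finset α) := by simp
  rcases (show #T = r + 1 ∨ #T = r + 2 by omega) with hd1 | hd2
  · have hij : i = j := by
      have : ({i} : Finset α) ⊆ {j} := subset_of_card_union_le (by simp at hc1 ⊢; omega)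
      simpa using this
    subst hij
    refine ⟨T.erase i, 0, 0, h.isBallPair_of_subset hw hr (erase_subset _ _) ?_ ?_ ?_⟩
    · rw [card_erase_of_mem hiT]; omega
    · intro F hF
      have := h.cross _ hF _ hG1
      have : F ⊆ {i} := subset_of_card_union_le (by rw [card_singleton]; omega)
      rw [Nat.le_zero, card_eq_zero]
      ext x
      have := @this x
      simp at this ⊢; tauto
    · intro F hF
      have := h.symm.cross _ hF _ hF1
      have : F ⊆ {i} := subset_of_card_union_le (by rw [card_singleton]; omega)
      rw [Nat.le_zero, card_eq_zero]
      ext x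
      have := @this x
      simp at this ⊢; tauto
  · clear hd hc1 hc2
    -- A pair `{i, j}` in `𝒜` confines `ℬ` to its subsets. If `ℬ` contains `{i, j}` too, both
    -- families live on `{i, j}`; otherwise only one of the singletons can belong to `ℬ`.
    have main : ∀ {𝒜 ℬ : Finset (Finset α)}, IsOpt w T r 𝒜 ℬ → (∃ G ∈ ℬ, G ≠ ∅) →
        (∃ F ∈ 𝒜, 2 ≤ #F) → ∃ U k l, IsBallPair T U r k l 𝒜 ℬ := by
      clear hF1 hG1 hiT hjT i j h
      rintro 𝒜 ℬ h ⟨G, hG, hG0⟩ ⟨F, hF, hF2⟩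
      have hF3 := h.cross F hF ∅ (h.symm.empty_mem hw hr)
      rw [union_empty] at hF3
      obtain ⟨i, j, hij, rfl⟩ := card_eq_two.1 (show #F = 2 by omega)
      have hT := h.subset_left _ hF
      have hiT : i ∈ T := hT (by simp)
      have hB : ∀ G ∈ ℬ, G ⊆ {i, j} := fun G hG => subset_of_card_union_le (by
        have := h.cross _ hF G hG
        rw [union_comm]; omega)
      by_cases hp : {i, j} ∈ ℬ
      · have hA : ∀ F ∈ 𝒜, F ⊆ {i, j} := fun F hF => subset_of_card_union_le (by
          have := h.cross F hF _ hp
          omega)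
        have hz : ∀ F ⊆ ({i, j} : Finset α), #(F ∩ (T \ {i, j})) ≤ 0 := by
          intro F hF
          rw [Nat.le_zero, card_eq_zero]
          ext x
          have := @hF x
          simp at this ⊢; tauto
        refine ⟨T \ {i, j}, 0, 0, h.isBallPair_of_subset hw hr sdiff_subset ?_
          (fun F hF => hz F (hA F hF)) (fun F hF => hz F (hB F hF))⟩
        have := card_sdiff_add_card_eq_card hT
        omega
      · have hone : ∀ {i j : α}, i ∈ T → i ≠ j → {i} ∈ ℬ → (∀ G ∈ ℬ, G ⊆ {i}) →
            ∃ U k l, IsBallPair T U r k l 𝒜 ℬ := by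
          intro i j hiT hij hiB hB
          refine ⟨T.erase i, 1, 0, h.isBallPair_of_subset hw hr (erase_subset _ _) ?_ ?_ ?_⟩
          · rw [card_erase_of_mem hiT]; omega
          · intro F hF
            have h1 := h.cross F hF _ hiB
            have h2 : insert i (F ∩ T.erase i) ⊆ F ∪ {i} := by
              intro x; simp; tauto
            have h3 := card_le_card h2
            rw [card_insert_of_notMem (by simp)] at h3
            omega
          · intro F hF
            have := hB F hF
            rw [Nat.le_zero, card_eq_zero]
            ext x
            have := @this x
            simp at this ⊢; tauto
        have hB' : ∀ G ∈ ℬ, G = ∅ ∨ G = {i} ∨ G = {j} := by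
          intro G hG
          have h1 := hB G hG
          rcases eq_of_subset_pair h1 with h | h | h | h
          · exact Or.inl h
          · exact Or.inr (Or.inl h)
          · exact Or.inr (Or.inr h)
          · exact absurd (h ▸ hG) hp
        by_cases hi : {i} ∈ ℬ
        · by_cases hj : {j} ∈ ℬ
          · exact (h.not_pair_of_singletons hw hd2 hij hi hj hB').elim
          · refine hone hiT hij hi fun G hG => ?_
            rcases hB' G hG with rfl | rfl | rfl
            · simp
            · simp
            · exact absurd hG hj
        · have hj : {j} ∈ ℬ := by
            rcases hB' G hG with rfl | rfl | rfl
            · exact absurd rfl hG0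
            · exact absurd hG hi
            · exact hG
          refine hone (hT (by simp)) hij.symm hj fun G hG => ?_
          rcases hB' G hG with rfl | rfl | rfl
          · simp
          · exact absurd hG hi
          · simp
    by_cases h2 : ∃ F ∈ 𝒜, 2 ≤ #F
    · exact main h ⟨_, hG1, by simp⟩ h2
    by_cases h3 : ∃ F ∈ ℬ, 2 ≤ #F
    · obtain ⟨U, k, l, hb⟩ := main h.symm ⟨_, hF1, by simp⟩ h3
      exact ⟨U, l, k, hb.symm⟩
    push Not at h2 h3
    refine ⟨T, 1, 1, h.isBallPair_of_subset hw hr Subset.rfl (by omega) ?_ ?_⟩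
    · intro F hF
      have := h2 F hF
      have := card_le_card (inter_subset_left (s₁ := F) (s₂ := T))
      omega
    · intro F hF
      have := h3 F hF
      have := card_le_card (inter_subset_left (s₁ := F) (s₂ := T))
      omega

end IsOpt

/-- Adding back a free point. -/
lemma IsBallPair.of_erase (hA : ∀ F ∈ 𝒜, F ⊆ T) (hB : ∀ F ∈ ℬ, F ⊆ T) (hi : i ∈ T)
    (fa : FreePoint 𝒜 i) (fb : FreePoint ℬ i)
    (h : IsBallPair (T.erase i) U r k l (𝒜.nonMemberSubfamily i) (ℬ.nonMemberSubfamily i)) :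
    IsBallPair T U r k l 𝒜 ℬ := by
  have hiU : i ∉ U := fun hx => by simpa using h.subset hx
  have key : ∀ (𝒞 : Finset (Finset α)) (m : ℕ), (∀ F ∈ 𝒞, F ⊆ T) → FreePoint 𝒞 i →
      𝒞.nonMemberSubfamily i = setBall (T.erase i) U m → 𝒞 = setBall T U m := by
    intro 𝒞 m _ hf he
    ext F
    have h1 : F.erase i ∈ 𝒞.nonMemberSubfamily i ↔ F ∈ 𝒞 := by
      rw [mem_nonMemberSubfamily, hf.mem_iff_erase F]
      simp
    rw [← h1, he, mem_setBall, mem_setBall]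
    have h2 : F.erase i ∩ U = F ∩ U := by
      ext x
      simp only [mem_inter, mem_erase]
      constructor
      · tauto
      · rintro ⟨h1, h2⟩
        exact ⟨⟨fun hx => hiU (hx ▸ h2), h1⟩, h2⟩
    have h3 : F.erase i ⊆ T.erase i ↔ F ⊆ T := by
      constructor
      · intro hF x hx
        by_cases hxi : x = i
        · rwa [hxi]
        · exact (mem_erase.1 (hF (mem_erase.2 ⟨hxi, hx⟩))).2
      · exact erase_subset_erase i
    rw [h2, h3]
  exact ⟨h.subset.trans (erase_subset _ _), h.card, key 𝒜 k hA fa h.left, key ℬ l hB fb h.right⟩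

/-- Induction principle removing free points until none is left. -/
lemma IsOpt.reduction (hw : ∀ i, 1 ≤ w i) {P : ℕ → ℕ → ℕ → Prop} {d : ℕ}
    (base : ∀ (T : Finset α) (𝒜 ℬ : Finset (Finset α)), IsOpt w T r 𝒜 ℬ → r ≤ #T → #T ≤ r + d →
      (∀ i ∈ T, ¬ (FreePoint 𝒜 i ∧ FreePoint ℬ i)) →
      ∃ U k l, IsBallPair T U r k l 𝒜 ℬ ∧ P k l #U) (m : ℕ) :
    ∀ (T R : Finset α) (𝒜 ℬ : Finset (Finset α)), #T = m → IsOpt w T r 𝒜 ℬ → r ≤ #T → #R ≤ r + d →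
      (∀ i ∈ T, i ∉ R → FreePoint 𝒜 i ∧ FreePoint ℬ i) →
      ∃ U k l, IsBallPair T U r k l 𝒜 ℬ ∧ P k l #U := by
  induction m with
  | zero =>
    intro T R 𝒜 ℬ hT h hr _ _
    exact base T 𝒜 ℬ h hr (by omega) (by simp [card_eq_zero.1 hT])
  | succ m ih =>
    intro T R 𝒜 ℬ hT h hr hR hf
    by_cases hex : ∃ i ∈ T, FreePoint 𝒜 i ∧ FreePoint ℬ i
    · obtain ⟨i, hi, fa, fb⟩ := hex
      obtain ⟨h', hr'⟩ := h.erase_freePoint hr hi fa fb hw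
      have hfree : ∀ (𝒞 : Finset (Finset α)) (j : α), j ≠ i → FreePoint 𝒞 j →
          FreePoint (𝒞.nonMemberSubfamily i) j := by
        intro 𝒞 j hj hf F
        simp only [mem_nonMemberSubfamily, hf F]
        simp [hj.symm]
      obtain ⟨U, k, l, hb, hP⟩ := ih (T.erase i) R _ _ (by rw [card_erase_of_mem hi]; omega) h' hr' hR
        (fun j hj hjR => by
          have hji := (mem_erase.1 hj).1
          have := hf j (mem_erase.1 hj).2 hjR
          exact ⟨hfree 𝒜 j hji this.1, hfree ℬ j hji this.2⟩)
      exact ⟨U, k, l, hb.of_erase h.subset_left h.subset_right hi fa fb, hP⟩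
    · push Not at hex
      -- Without free points, `T ⊆ R`, which bounds the size of `T`.
      refine base T 𝒜 ℬ h hr ?_ fun i hi hh => hex i hi hh.1 hh.2
      refine le_trans (card_le_card fun i hi => ?_) hR
      by_contra hiR
      exact hex i hi (hf i hi hiR).1 (hf i hi hiR).2

end BallPair

/-! ### Three points of slack: excluding triples. -/

section SlackThree

variable {α : Type*} [DecidableEq α] {w : α → ℕ} {𝒜 ℬ : Finset (Finset α)} {T : Finset α}
  {r : ℕ} {i j k l : α}

/-- An optimal pair with three points of slack and weights at least two, in which all points are
rare. -/
structure IsRareOpt (w : α → ℕ) (T : Finset α) (r : ℕ) (𝒜 ℬ : Finset (Finset α)) : Prop where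
  opt : IsOpt w T r 𝒜 ℬ
  two_le : ∀ i, 2 ≤ w i
  card : #T = r + 3
  one_le : 1 ≤ r
  rare_left : ∀ i ∈ T,
    w i ^ 2 * wt w (𝒜.memberSubfamily i) ≤ wt w (𝒜.nonMemberSubfamily i)
  rare_right : ∀ i ∈ T,
    w i ^ 2 * wt w (ℬ.memberSubfamily i) ≤ wt w (ℬ.nonMemberSubfamily i)

namespace IsRareOpt

lemma symm (h : IsRareOpt w T r 𝒜 ℬ) : IsRareOpt w T r ℬ 𝒜 :=
  ⟨h.opt.symm, h.two_le, h.card, h.one_le, h.rare_right, h.rare_left⟩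

lemma one_le_weight (h : IsRareOpt w T r 𝒜 ℬ) (i : α) : 1 ≤ w i :=
  one_le_two.trans (h.two_le i)

lemma card_union_le (h : IsRareOpt w T r 𝒜 ℬ) {F G : Finset α} (hF : F ∈ 𝒜) (hG : G ∈ ℬ) :
    #(F ∪ G) ≤ 3 := by
  have := h.opt.cross F hF G hG
  have := h.card
  omega

lemma mem_of_subset (h : IsRareOpt w T r 𝒜 ℬ) {F F' : Finset α} (hF : F ∈ 𝒜) (hF' : F' ⊆ F) :
    F' ∈ 𝒜 :=
  h.opt.mem_of_subset h.one_le_weight (by rw [h.card]; omega) hF hF'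

lemma mem_of_forall (h : IsRareOpt w T r 𝒜 ℬ) {F : Finset α} (hF : F ⊆ T)
    (hc : ∀ G ∈ ℬ, #(F ∪ G) ≤ 3) : F ∈ 𝒜 := by
  have hT := h.card
  refine h.opt.mem_of_forall h.one_le_weight (by omega) hF fun G hG => ?_
  have := hc G hG
  omega

lemma le_rare (h : IsRareOpt w T r 𝒜 ℬ) (hi : i ∈ T) {m M : ℕ}
    (hm : m ≤ wt w (𝒜.memberSubfamily i)) (hM : wt w (𝒜.nonMemberSubfamily i) ≤ M) :
    w i ^ 2 * m ≤ M :=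
  (Nat.mul_le_mul_left _ hm).trans ((h.rare_left i hi).trans hM)

/-- Since `1 ≤ r`, there is a fourth point `l`. Giving up the triple, of weight 8, lets the other
family grow from weight at most 7 to all sets of at most one point, of weight at least `7 + w l`. As
`𝒜` is heavy, this trade pays. -/
lemma not_triple_of_weight_two (h : IsRareOpt w T r 𝒜 ℬ) (hij : i ≠ j) (hik : i ≠ k) (hjk : j ≠ k)
    (hA : {i, j, k} ∈ 𝒜) (hB : ℬ ⊆ smallSets {i, j, k}) (hi : {i} ∈ ℬ) (hj : {j} ∈ ℬ)
    (hk : {k} ∈ ℬ) (wi : w i = 2) (wj : w j = 2) (wk : w k = 2) : False := by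
  have hT := h.card
  have hr := h.one_le
  have h3 : #({i, j, k} : Finset α) = 3 := card_eq_three.2 ⟨i, j, k, hij, hik, hjk, rfl⟩
  have hs := h.opt.subset_left _ hA
  obtain ⟨l, hlT, hl⟩ : ∃ l ∈ T, l ∉ ({i, j, k} : Finset α) :=
    exists_mem_notMem_of_card_lt_card (by omega)
  have hsmall : ∀ F ⊆ T, #F ≤ 2 → F ∈ 𝒜 := fun F hF hc => h.mem_of_forall hF fun G hG => by
    have := (mem_smallSets.1 (hB hG)).2
    have := Finset.card_union_le F G
    omega
  have l0 : wt w ({i, j, k} : Finset α).powerset ≤ wt w (𝒜.nonMemberSubfamily l) :=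
    wt_mono fun F hF => by
      rw [mem_powerset] at hF
      exact mem_nonMemberSubfamily.2 ⟨h.mem_of_subset hA hF, fun hx => hl (hF hx)⟩
  have l1 : wt w (smallSets {i, j, k}) ≤ wt w (𝒜.memberSubfamily l) :=
    wt_mono fun F hF => by
      rw [mem_smallSets] at hF
      refine mem_memberSubfamily.2 ⟨hsmall _ (insert_subset hlT (hF.1.trans hs)) ?_,
        fun hx => hl (hF.1 hx)⟩
      have := card_insert_le l F
      omega
  have hsum : ∑ x ∈ ({i, j, k} : Finset α), w x = 6 := by
    rw [sum_insert (by simp [hij, hik]), sum_pair hjk, wi, wj, wk]; norm_num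
  have hprod : ∏ x ∈ ({i, j, k} : Finset α), w x = 8 := by
    rw [prod_insert (by simp [hij, hik]), prod_pair hjk, wi, wj, wk]; norm_num
  have hprod1 : ∏ x ∈ ({i, j, k} : Finset α), (1 + w x) = 27 := by
    rw [prod_insert (by simp [hij, hik]), prod_pair hjk, wi, wj, wk]; norm_num
  rw [wt_powerset, hprod1] at l0
  rw [wt_smallSets, hsum] at l1
  have ha := wt_split (w := w) l 𝒜
  have hb := wt_mono (w := w) hB
  rw [wt_smallSets, hsum] at hb
  have he : wt w 𝒜 = 8 + wt w (𝒜.erase {i, j, k}) := by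
    rw [← hprod, ← wt_insert (notMem_erase _ _), insert_erase hA]
  have hT' : 6 + w l ≤ ∑ x ∈ T, w x := by
    have := sum_le_sum_of_subset (f := w) (insert_subset hlT hs)
    rw [sum_insert hl, hsum] at this
    omega
  have hm := h.opt.max (𝒜.erase {i, j, k}) (smallSets T)
    (fun F hF => h.opt.subset_left F (mem_of_mem_erase hF)) (fun F hF => (mem_smallSets.1 hF).1)
    (by
      intro F hF G hG
      have hc := (mem_smallSets.1 hG).2
      have hF' := mem_of_mem_erase hF
      have hF2 : #F ≤ 2 := by
        by_contra hF3
        have hin : ∀ x, {x} ∈ ℬ → x ∈ F := fun x hx => by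
          have := h.card_union_le hF' hx
          exact singleton_subset_iff.1
            (subset_of_card_union_le (by rw [union_comm]; omega))
        have hle := h.card_union_le hF' hi
        have := card_le_card (subset_union_left (s₁ := F) (s₂ := {i}))
        refine ne_of_mem_erase hF (eq_of_subset_of_card_le ?_ (by omega)).symm
        simp [insert_subset_iff, hin i hi, hin j hj, hin k hk]
      have := Finset.card_union_le F G
      omega)
  rw [wt_smallSets] at hm
  have hwl := h.two_le l
  generalize wt w (𝒜.erase {i, j, k}) = a at *
  generalize wt w (𝒜.nonMemberSubfamily l) = a0 at *
  generalize wt w (𝒜.memberSubfamily l) = a1 at *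
  generalize wt w 𝒜 = A at *
  generalize wt w ℬ = B at *
  generalize w l = v at *
  have h1 : a * (7 + v) ≤ (8 + a) * 7 := by
    subst he
    calc a * (7 + v) ≤ a * (1 + ∑ x ∈ T, w x) := Nat.mul_le_mul_left _ (by omega)
      _ ≤ (8 + a) * B := hm
      _ ≤ (8 + a) * 7 := Nat.mul_le_mul_left _ (by omega)
  have h2 : 19 + 7 * v ≤ a := by nlinarith
  nlinarith

/-- The triple confines `ℬ` to its subsets, so rarity in `ℬ` can be tested at the heaviest point `m`
whose singleton lies in `ℬ`. It fails whenever a singleton is missing or a pair contains `m`; the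
pair of the other two points is excluded by rarity at all three. With no pairs, only weights equal
to two survive. -/
lemma not_triple (h : IsRareOpt w T r 𝒜 ℬ) {F : Finset α} (hF : F ∈ 𝒜) (hF3 : #F = 3)
    (hℬ : ∃ G ∈ ℬ, G ≠ ∅) : False := by
  have hsub : ∀ G ∈ ℬ, G ⊆ F := fun G hG => subset_of_card_union_le (by
    rw [union_comm, hF3]; exact h.card_union_le hF hG)
  obtain ⟨m, hm, hmax⟩ := exists_max_image (F.filter fun x => {x} ∈ ℬ) w (by
    obtain ⟨G, hG, hne⟩ := hℬ
    obtain ⟨x, hx⟩ := nonempty_iff_ne_empty.2 hne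
    exact ⟨x, mem_filter.2
      ⟨hsub G hG hx, h.symm.mem_of_subset hG (singleton_subset_iff.2 hx)⟩⟩)
  rw [mem_filter] at hm
  have hmT : m ∈ T := h.opt.subset_left F hF hm.1
  obtain ⟨j, k, hjk, hFe⟩ := card_eq_two.1
    (show #(F.erase m) = 2 by rw [card_erase_of_mem hm.1, hF3])
  have hFm : F = {m, j, k} := by rw [← insert_erase hm.1, hFe]
  have hmj : m ≠ j := by
    rintro rfl
    have : m ∈ F.erase m := by rw [hFe]; simp
    simp at this
  have hmk : m ≠ k := by
    rintro rfl
    have : m ∈ F.erase m := by rw [hFe]; simp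
    simp at this
  have hmaxj : {j} ∈ ℬ → w j ≤ w m := fun hj => hmax j (mem_filter.2 ⟨by simp [hFm], hj⟩)
  have hmaxk : {k} ∈ ℬ → w k ≤ w m := fun hk => hmax k (mem_filter.2 ⟨by simp [hFm], hk⟩)
  have hjT : j ∈ T := h.opt.subset_left F hF (by simp [hFm])
  have hkT : k ∈ T := h.opt.subset_left F hF (by simp [hFm])
  subst hFm
  clear hmax hFe hℬ
  have w2m := h.two_le m
  have w2j := h.two_le j
  have w2k := h.two_le k
  have sing : ∀ {G : Finset α} {x}, G ∈ ℬ → x ∈ G → {x} ∈ ℬ := fun hG hx =>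
    h.symm.mem_of_subset hG (singleton_subset_iff.2 hx)
  have pair : ∀ {G : Finset α} {x y}, G ∈ ℬ → x ∈ G → y ∈ G → {x, y} ∈ ℬ := fun hG hx hy =>
    h.symm.mem_of_subset hG (by simp [insert_subset_iff, hx, hy])
  have hemp : ∅ ∈ ℬ := h.symm.mem_of_subset hm.2 (empty_subset _)
  have one_le : 1 ≤ wt w (ℬ.memberSubfamily m) := by
    have := wt_mono (w := w) (𝒜 := {∅}) (ℬ := ℬ.memberSubfamily m) (by simpa using hm.2)
    simpa [wt_singleton] using this
  have upper : ∀ S : Finset α, (∀ x ∈ ({j, k} : Finset α), {x} ∈ ℬ → x ∈ S) →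
      wt w (ℬ.nonMemberSubfamily m) ≤ ∏ x ∈ S, (1 + w x) := by
    intro S hS
    rw [← wt_powerset]
    refine wt_mono fun G hG => mem_powerset.2 fun x hx => ?_
    rw [mem_nonMemberSubfamily] at hG
    refine hS x ?_ (sing hG.1 hx)
    have := hsub G hG.1 hx
    rw [mem_insert] at this
    exact this.resolve_left fun he => hG.2 (he ▸ hx)
  by_cases hj : {j} ∈ ℬ
  swap
  · have := h.symm.le_rare hmT one_le (upper {k} (by simp [hj]))
    rw [prod_singleton] at this
    by_cases hk : {k} ∈ ℬ
    · nlinarith [hmaxk hk]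
    · have := h.symm.le_rare hmT one_le (upper ∅ (by simp [hj, hk]))
      rw [prod_empty] at this
      nlinarith
  by_cases hk : {k} ∈ ℬ
  swap
  · have := h.symm.le_rare hmT one_le (upper {j} (by simp [hk]))
    rw [prod_singleton] at this
    nlinarith [hmaxj hj]
  have hmaxj := hmaxj hj
  have hmaxk := hmaxk hk
  have upper2 := upper {j, k} (by simp)
  rw [prod_pair hjk] at upper2
  have lower : ∀ {x y : α}, x ≠ y → {x} ∈ ℬ → {x, y} ∈ ℬ →
      1 + w y ≤ wt w (ℬ.memberSubfamily x) := by
    intro x y hxy hx hxy'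
    have : smallSets {y} ⊆ ℬ.memberSubfamily x := by
      intro G hG
      rw [mem_smallSets'] at hG
      rcases hG with rfl | ⟨z, hz, rfl⟩
      · simpa using hx
      · rw [mem_singleton] at hz
        subst hz
        simpa [hxy] using hxy'
    have := wt_mono (w := w) this
    rwa [wt_smallSets, sum_singleton] at this
  by_cases hpj : {m, j} ∈ ℬ
  · have := h.symm.le_rare hmT (lower hmj hm.2 hpj) upper2
    nlinarith
  by_cases hpk : {m, k} ∈ ℬ
  · have := h.symm.le_rare hmT (lower hmk hm.2 hpk) upper2
    nlinarith
  have small_of : ∀ {G : Finset α}, G ∈ ℬ → (∀ x ∈ G, ∀ y ∈ G, x ≠ y → False) →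
      G ∈ smallSets {m, j, k} := fun {G} hG hh => mem_smallSets.2
    ⟨hsub G hG, card_le_one.2 fun x hx y hy => by_contra fun hne => hh x hx y hy hne⟩
  by_cases hp : {j, k} ∈ ℬ
  · have key : ∀ {x y : α}, x ≠ m → ({m, j, k} : Finset α) ⊆ {x, y, m} → {y, m} ∉ ℬ → y ≠ m →
        wt w (ℬ.nonMemberSubfamily x) ≤ 1 + (w y + w m) := by
      intro x y hxm hs hym hne
      rw [← sum_pair hne, ← wt_smallSets]
      refine wt_mono fun G hG => ?_
      rw [mem_nonMemberSubfamily] at hG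
      have hG' : G ⊆ {y, m} := fun z hz => by
        have := hs (hsub G hG.1 hz)
        rw [mem_insert] at this
        exact this.resolve_left fun he => hG.2 (he ▸ hz)
      rw [mem_smallSets']
      rcases eq_of_subset_pair hG' with rfl | rfl | rfl | rfl
      · exact Or.inl rfl
      · exact Or.inr ⟨y, by simp, rfl⟩
      · exact Or.inr ⟨m, by simp, rfl⟩
      · exact absurd hG.1 hym
    have r1 := h.symm.le_rare hjT (lower hjk hj hp)
      (key hmj.symm (by intro x; simp; tauto) (by rwa [pair_comm]) hmk.symm)
    have r2 := h.symm.le_rare hkT (lower hjk.symm hk (by rwa [pair_comm]))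
      (key hmk.symm (by intro x; simp; tauto) (by rwa [pair_comm]) hmj.symm)
    have r3 := h.symm.le_rare hmT one_le upper2
    -- Rarity at `j` and `k` makes `m` at least three times as heavy as `1 + w k` and `1 + w j`,
    -- which contradicts rarity at `m`.
    have q1 : 3 * (1 + w k) ≤ w m := by nlinarith
    have q2 : 3 * (1 + w j) ≤ w m := by nlinarith
    nlinarith [Nat.mul_le_mul q1 q2]
  · have hB : ℬ ⊆ smallSets {m, j, k} := by
      intro G hG
      refine small_of hG fun x hx y hy hne => ?_
      have hx' := hsub G hG hx
      have hy' := hsub G hG hy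
      have hxy := pair hG hx hy
      simp only [mem_insert, mem_singleton] at hx' hy'
      rcases hx' with rfl | rfl | rfl <;> rcases hy' with rfl | rfl | rfl <;>
        first
        | exact hne rfl
        | contradiction
        | (rw [pair_comm] at hxy; contradiction)
    have hM : wt w (ℬ.nonMemberSubfamily m) ≤ 1 + (w j + w k) := by
      rw [← sum_pair hjk, ← wt_smallSets]
      refine wt_mono fun G hG => ?_
      rw [mem_nonMemberSubfamily] at hG
      have := mem_smallSets.1 (hB hG.1)
      refine mem_smallSets.2 ⟨fun z hz => ?_, this.2⟩
      have := this.1 hz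
      rw [mem_insert] at this
      exact this.resolve_left fun he => hG.2 (he ▸ hz)
    have r := h.symm.le_rare hmT one_le hM
    have hm2 : w m = 2 := by nlinarith
    exact h.not_triple_of_weight_two hmj hmk hjk hF hB hm.2 hj hk hm2 (by omega) (by omega)

end IsRareOpt

end SlackThree

/-! ### Cross-intersecting graphs: stars and triangles. -/

section Graphs

variable {α : Type*} [DecidableEq α] {w : α → ℕ} {𝒜 ℬ : Finset (Finset α)} {T : Finset α}
  {r : ℕ} {i j k l : α}

/-- As in `IsRareOpt`, all sets having at most two points, so that pairs of points form two
cross-intersecting graphs. -/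
structure IsGraphOpt (w : α → ℕ) (T : Finset α) (r : ℕ) (𝒜 ℬ : Finset (Finset α)) : Prop
    extends IsRareOpt w T r 𝒜 ℬ where
  card_left : ∀ F ∈ 𝒜, #F ≤ 2
  card_right : ∀ F ∈ ℬ, #F ≤ 2

namespace IsGraphOpt

lemma symm (h : IsGraphOpt w T r 𝒜 ℬ) : IsGraphOpt w T r ℬ 𝒜 :=
  ⟨h.toIsRareOpt.symm, h.card_right, h.card_left⟩

lemma small_mem (h : IsGraphOpt w T r 𝒜 ℬ) : smallSets T ⊆ 𝒜 := fun F hF => by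
  rw [mem_smallSets] at hF
  refine h.mem_of_forall hF.1 fun G hG => ?_
  have := h.card_right G hG
  have := Finset.card_union_le F G
  omega

lemma mem_cases (h : IsGraphOpt w T r 𝒜 ℬ) {F : Finset α} (hF : F ∈ 𝒜) :
    F ∈ smallSets T ∨ ∃ x y, x ≠ y ∧ F = {x, y} ∧ x ∈ T ∧ y ∈ T := by
  have hT := h.opt.subset_left F hF
  by_cases hc : #F ≤ 1
  · exact Or.inl (mem_smallSets.2 ⟨hT, hc⟩)
  · have := h.card_left F hF
    obtain ⟨x, y, hxy, rfl⟩ := card_eq_two.1 (show #F = 2 by omega)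
    exact Or.inr ⟨x, y, hxy, rfl, hT (by simp), hT (by simp)⟩

lemma meet (h : IsGraphOpt w T r 𝒜 ℬ) (hij : i ≠ j) (hkl : k ≠ l) (hA : {i, j} ∈ 𝒜)
    (hB : {k, l} ∈ ℬ) : i = k ∨ i = l ∨ j = k ∨ j = l := by
  by_contra hn
  push Not at hn
  have := h.card_union_le hA hB
  rw [card_union_of_disjoint (by
    simp [hn.1.symm, hn.2.1.symm, hn.2.2.1.symm, hn.2.2.2.symm]), card_pair hij,
    card_pair hkl] at this
  omega

/-- Saturation in graph terms: only pairs of `ℬ` can obstruct, as unions with smaller sets have at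
most three points. -/
lemma pair_mem (h : IsGraphOpt w T r 𝒜 ℬ) (hij : i ≠ j) (hi : i ∈ T) (hj : j ∈ T)
    (hm : ∀ k l, k ≠ l → {k, l} ∈ ℬ → i = k ∨ i = l ∨ j = k ∨ j = l) : {i, j} ∈ 𝒜 := by
  refine h.mem_of_forall (by simp [insert_subset_iff, hi, hj]) fun G hG => ?_
  rcases h.symm.mem_cases hG with hs | ⟨x, y, hxy, rfl, -, -⟩
  · have := (mem_smallSets.1 hs).2
    have := Finset.card_union_le {i, j} G
    rw [card_pair hij] at this
    omega
  · have h1 := card_union_add_card_inter {i, j} {x, y}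
    rw [card_pair hij, card_pair hxy] at h1
    have : 0 < #({i, j} ∩ {x, y} : Finset α) := by
      rw [card_pos]
      rcases hm x y hxy hG with rfl | rfl | rfl | rfl
      · exact ⟨i, by simp⟩
      · exact ⟨i, by simp⟩
      · exact ⟨j, by simp⟩
      · exact ⟨j, by simp⟩
    omega

lemma mem_left (h : IsGraphOpt w T r 𝒜 ℬ) (hA : {i, j} ∈ 𝒜) : i ∈ T :=
  h.opt.subset_left _ hA (by simp)

/-- Lower bound for the link of `i` from a set of neighbours. -/
lemma le_link (h : IsGraphOpt w T r 𝒜 ℬ) (hi : i ∈ T) (S : Finset α) (hiS : i ∉ S)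
    (hS : ∀ x ∈ S, {i, x} ∈ 𝒜) : 1 + ∑ x ∈ S, w x ≤ wt w (𝒜.memberSubfamily i) := by
  rw [← wt_smallSets]
  refine wt_mono fun F hF => ?_
  rw [mem_smallSets'] at hF
  rw [mem_memberSubfamily]
  rcases hF with rfl | ⟨x, hx, rfl⟩
  · exact ⟨h.small_mem (mem_smallSets.2 ⟨by simpa using hi, by simp⟩), by simp⟩
  · refine ⟨hS x hx, ?_⟩
    rw [mem_singleton]
    rintro rfl
    exact hiS hx

/-- Upper bound for the total weight from a set of pairs. -/
lemma wt_le (E : Finset (Finset α)) (hE : 𝒜 ⊆ smallSets T ∪ E) :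
    wt w 𝒜 ≤ 1 + ∑ x ∈ T, w x + wt w E := by
  rw [← wt_smallSets]
  exact (wt_mono hE).trans wt_union_le

/-- Upper bound for the deletion of `i` from a set of pairs. -/
lemma deletion_le (h : IsGraphOpt w T r 𝒜 ℬ) (i : α) (E : Finset (Finset α))
    (hE : ∀ x y, x ≠ y → {x, y} ∈ 𝒜 → x ≠ i → y ≠ i → {x, y} ∈ E) :
    wt w (𝒜.nonMemberSubfamily i) ≤ 1 + ∑ x ∈ T.erase i, w x + wt w E := by
  rw [← wt_smallSets]
  refine (wt_mono (fun F hF => ?_)).trans wt_union_le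
  rw [mem_nonMemberSubfamily] at hF
  rw [mem_union]
  rcases h.mem_cases hF.1 with hs | ⟨x, y, hxy, rfl, -, -⟩
  · rw [mem_smallSets] at hs
    exact Or.inl (mem_smallSets.2 ⟨subset_erase.2 ⟨hs.1, hF.2⟩, hs.2⟩)
  · have := hF.2
    simp only [mem_insert, mem_singleton, not_or] at this
    exact Or.inr (hE x y hxy hF.1 (Ne.symm this.1) (Ne.symm this.2))

lemma sum_erase_eq (hj : j ∈ T) (hij : i ≠ j) :
    ∑ x ∈ T.erase i, w x = w j + ∑ x ∈ (T.erase i).erase j, w x :=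
  (add_sum_erase _ w (mem_erase.2 ⟨hij.symm, hj⟩)).symm

/-- If `{i, j}` is in one family, the sets of the other one avoiding `i` are limited. -/
lemma deletion_le_of_pair (h : IsGraphOpt w T r 𝒜 ℬ) (hij : i ≠ j) (hB : {i, j} ∈ ℬ) :
    wt w (𝒜.nonMemberSubfamily i) ≤ (1 + w j) * (1 + ∑ x ∈ (T.erase i).erase j, w x) := by
  have hi : i ∈ T := h.symm.mem_left hB
  have hj : j ∈ T := h.symm.mem_left (i := j) (j := i) (by rwa [pair_comm])
  have h1 := h.deletion_le i (((T.erase i).erase j).image fun m => {j, m}) (by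
    intro x y hxy hA hxi hyi
    have hx := h.mem_left hA
    have hy := h.mem_left (i := y) (j := x) (by rwa [pair_comm])
    rw [mem_image]
    rcases h.meet hxy hij hA hB with rfl | rfl | rfl | rfl
    · exact absurd rfl hxi
    · exact ⟨y, by simp [hyi, hxy.symm, hy], rfl⟩
    · exact absurd rfl hyi
    · exact ⟨x, by simp [hxi, hxy, hx], pair_comm _ _⟩)
  have h2 := wt_image_pair_le (w := w) j ((T.erase i).erase j) (by simp)
  rw [sum_erase_eq hj hij] at h1
  refine h1.trans ((Nat.add_le_add_left h2 _).trans (le_of_eq ?_))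
  ring

/-- The pairs of `ℬ` do not share a point. -/
lemma not_star (h : IsGraphOpt w T r 𝒜 ℬ) (hi : i ∈ T) (hB : ∃ F ∈ ℬ, #F = 2)
    (hstar : ∀ x y, x ≠ y → {x, y} ∈ ℬ → x = i ∨ y = i) : False := by
  have full : ∀ i ∈ T, (∀ x y, x ≠ y → {x, y} ∈ ℬ → x = i ∨ y = i) →
      1 + ∑ x ∈ T.erase i, w x ≤ wt w (𝒜.memberSubfamily i) := by
    intro i hi hstar
    refine h.le_link hi _ (by simp) fun x hx => ?_
    rw [mem_erase] at hx
    refine h.pair_mem hx.1.symm hi hx.2 fun k l hkl hm => ?_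
    rcases hstar k l hkl hm with rfl | rfl
    · exact Or.inl rfl
    · exact Or.inr (Or.inl rfl)
  obtain ⟨j, hij, hjB⟩ : ∃ j, i ≠ j ∧ {i, j} ∈ ℬ := by
    obtain ⟨F, hF, hc⟩ := hB
    obtain ⟨x, y, hxy, rfl⟩ := card_eq_two.1 hc
    rcases hstar x y hxy hF with rfl | rfl
    · exact ⟨y, hxy, hF⟩
    · exact ⟨x, hxy.symm, by rwa [pair_comm]⟩
  have hjT : j ∈ T := h.symm.mem_left (i := j) (j := i) (by rwa [pair_comm])
  have hjB' : {j, i} ∈ ℬ := by rwa [pair_comm]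
  -- A single edge is a star around either end, so the heavier end may be tested. With two edges
  -- `{i, j}` and `{i, k}`, the only pair of `𝒜` avoiding `i` is `{j, k}`, and rarity at `j`
  -- controls its weight.
  by_cases honly : ∀ x, i ≠ x → {i, x} ∈ ℬ → x = j
  · have hstar' : ∀ x y, x ≠ y → {x, y} ∈ ℬ → x = j ∨ y = j := by
      intro x y hxy hm
      rcases hstar x y hxy hm with rfl | rfl
      · exact Or.inr (honly y hxy hm)
      · exact Or.inl (honly x hxy.symm (by rwa [pair_comm]))
    have key : ∀ {i j : α}, i ∈ T → j ∈ T → i ≠ j → {i, j} ∈ ℬ →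
        (∀ x y, x ≠ y → {x, y} ∈ ℬ → x = i ∨ y = i) → w j ≤ w i → False := by
      intro i j hi hj hij hm hs hle
      have h1 := h.le_rare hi (full i hi hs) (h.deletion_le_of_pair hij hm)
      rw [sum_erase_eq hj hij] at h1
      have h2 := h.two_le i
      have h3 := h.two_le j
      generalize ∑ x ∈ (T.erase i).erase j, w x = s at *
      generalize w i = a at *
      generalize w j = b at *
      have : (1 + a) * (1 + s) < a ^ 2 * (1 + (b + s)) := by
        have h4 : 1 + a ≤ a ^ 2 := by nlinarith
        have h5 : (1 + a) * (1 + s) ≤ a ^ 2 * (1 + s) := Nat.mul_le_mul_right _ h4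
        have h6 : 0 < a ^ 2 * b := by positivity
        nlinarith
      have : (1 + b) * (1 + s) ≤ (1 + a) * (1 + s) := Nat.mul_le_mul_right _ (by omega)
      omega
    rcases le_total (w j) (w i) with hle | hle
    · exact key hi hjT hij hjB hstar hle
    · exact key hjT hi hij.symm hjB' hstar' hle
  · push Not at honly
    obtain ⟨k, hik, hkB, hkj⟩ := honly
    have key : ∀ {j k : α}, i ≠ j → i ≠ k → j ≠ k → {i, j} ∈ ℬ → {i, k} ∈ ℬ → w k ≤ w j →
        False := by
      intro j k hij hik hjk hjB hkB hle
      have hj : j ∈ T := h.symm.mem_left (i := j) (j := i) (by rwa [pair_comm])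
      have h1 := h.le_rare hi (full i hi hstar) (h.deletion_le i {{j, k}} (by
        intro x y hxy hA hxi hyi
        rw [mem_singleton]
        rcases h.meet hxy hij hA hjB with rfl | rfl | rfl | rfl
        · exact absurd rfl hxi
        · rcases h.meet hxy hik hA hkB with rfl | rfl | rfl | rfl
          · exact absurd rfl hxi
          · exact absurd rfl hjk
          · exact absurd rfl hyi
          · rfl
        · exact absurd rfl hyi
        · rcases h.meet hxy hik hA hkB with rfl | rfl | rfl | rfl
          · exact absurd rfl hxi
          · exact pair_comm _ _
          · exact absurd rfl hyi
          · exact absurd rfl hjk))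
      rw [sum_erase_eq hj hij, wt_singleton, prod_pair hjk] at h1
      have h2 := h.le_rare hj (h.le_link hj {i} (by simpa using hij.symm) (by
        intro x hx
        rw [mem_singleton] at hx
        subst hx
        refine h.pair_mem hij.symm hj hi fun k l hkl hm => ?_
        rcases hstar k l hkl hm with rfl | rfl
        · exact Or.inr (Or.inr (Or.inl rfl))
        · exact Or.inr (Or.inr (Or.inr rfl))))
        (h.deletion_le_of_pair hij.symm (by rwa [pair_comm]))
      rw [sum_singleton, erase_right_comm] at h2
      have w1 := h.two_le i
      have w2 := h.two_le j
      generalize ∑ x ∈ (T.erase i).erase j, w x = s at *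
      generalize w i = a at *
      generalize w j = b at *
      generalize w k = c at *
      have q1 : b ^ 2 ≤ 1 + s :=
        le_of_mul_le_mul_right (h2.trans (le_of_eq (mul_comm _ _))) (by omega)
      have q2 : 4 ≤ a ^ 2 := by nlinarith
      have q3 := Nat.mul_le_mul_right (1 + (b + s)) q2
      have q4 : b * c ≤ b ^ 2 := by nlinarith
      nlinarith
    rcases le_total (w k) (w j) with hle | hle
    · exact key hij hik hkj.symm hjB hkB hle
    · exact key hik hij hkj hkB hjB hle

/-- The comparison with the families of all sets having at most one point other than `i`. -/
lemma star_le (h : IsGraphOpt w T r 𝒜 ℬ) (hi : i ∈ T) :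
    ((1 + w i) * (1 + ∑ x ∈ T.erase i, w x)) ^ 2 ≤ wt w 𝒜 * wt w ℬ := by
  have hn : ∀ F ∈ smallSets (T.erase i), i ∉ F := fun F hF hx => by
    simpa using (mem_smallSets.1 hF).1 hx
  rw [← wt_smallSets, ← wt_double hn, sq]
  have hd : ∀ F ∈ double i (smallSets (T.erase i)), F ⊆ T ∧ #(F.erase i) ≤ 1 := by
    intro F hF
    simp only [double, mem_union, mem_image] at hF
    rcases hF with hF | ⟨G, hF, rfl⟩
    · have h1 := mem_smallSets.1 hF
      exact ⟨h1.1.trans (erase_subset _ _), (card_le_card (erase_subset _ _)).trans h1.2⟩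
    · have h1 := mem_smallSets.1 hF
      rw [erase_insert (hn _ hF)]
      exact ⟨insert_subset hi (h1.1.trans (erase_subset _ _)), h1.2⟩
  refine h.opt.max _ _ (fun F hF => (hd F hF).1) (fun F hF => (hd F hF).1) fun F hF G hG => ?_
  have h1 : F ∪ G ⊆ insert i (F.erase i ∪ G.erase i) := by
    intro x
    simp only [mem_union, mem_insert, mem_erase]
    tauto
  have h2 := card_le_card h1
  have h3 := card_insert_le i (F.erase i ∪ G.erase i)
  have h4 := Finset.card_union_le (F.erase i) (G.erase i)
  have h5 := (hd F hF).2
  have h6 := (hd G hG).2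
  have := h.card
  omega

/-- By the inequality of arithmetic and geometric means, `star_le` bounds the sum of the two weights
from below. Here `E` bounds the average weight of the pairs in the two families. -/
lemma sum_erase_le (h : IsGraphOpt w T r 𝒜 ℬ) (hi : i ∈ T) {E : ℕ}
    (hE : wt w 𝒜 + wt w ℬ ≤ 2 * (1 + ∑ x ∈ T, w x) + 2 * E) :
    w i * ∑ x ∈ T.erase i, w x ≤ E := by
  have h1 := h.star_le hi
  rw [← add_sum_erase _ w hi] at hE
  generalize ∑ x ∈ T.erase i, w x = s at *
  generalize w i = v at *
  generalize wt w 𝒜 = a at *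
  generalize wt w ℬ = b at *
  have h2 : 2 * ((1 + v) * (1 + s)) ≤ a + b := by
    by_contra hlt
    push Not at hlt
    zify at hlt h1
    nlinarith [sq_nonneg ((a : ℤ) - b)]
  nlinarith

/-- Each triangle forces the pairs of the other family to be its edges. Comparison with the star at
the heaviest vertex `i` then makes the rest of `T` light, and rarity at `i` fails. -/
lemma not_triangle (h : IsGraphOpt w T r 𝒜 ℬ) (hij : i ≠ j) (hik : i ≠ k) (hjk : j ≠ k)
    (aij : {i, j} ∈ 𝒜) (aik : {i, k} ∈ 𝒜) (ajk : {j, k} ∈ 𝒜)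
    (bij : {i, j} ∈ ℬ) (bik : {i, k} ∈ ℬ) (bjk : {j, k} ∈ ℬ) (hj : w j ≤ w i)
    (hk : w k ≤ w i) : False := by
  have hi : i ∈ T := h.mem_left aij
  have hjT : j ∈ T := h.mem_left ajk
  have hkT : k ∈ T := h.mem_left (i := k) (j := j) (by rwa [pair_comm])
  have tri : ∀ {𝒜 ℬ : Finset (Finset α)}, IsGraphOpt w T r 𝒜 ℬ → {i, j} ∈ ℬ → {i, k} ∈ ℬ →
      {j, k} ∈ ℬ → ∀ x y, x ≠ y → {x, y} ∈ 𝒜 → {x, y} = ({i, j} : Finset α) ∨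
        {x, y} = ({i, k} : Finset α) ∨ {x, y} = ({j, k} : Finset α) := by
    intro 𝒜 ℬ h bij bik bjk x y hxy hA
    have h1 := h.meet hxy hij hA bij
    have h2 := h.meet hxy hik hA bik
    have h3 := h.meet hxy hjk hA bjk
    grind
  have tot : ∀ {𝒜 ℬ : Finset (Finset α)}, IsGraphOpt w T r 𝒜 ℬ → {i, j} ∈ ℬ → {i, k} ∈ ℬ →
      {j, k} ∈ ℬ → wt w 𝒜 ≤ 1 + ∑ x ∈ T, w x + (w i * w j + (w i * w k + w j * w k)) := by
    intro 𝒜 ℬ h bij bik bjk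
    refine (wt_le {{i, j}, {i, k}, {j, k}} fun F hF => ?_).trans (Nat.add_le_add_left ?_ _)
    · rw [mem_union]
      rcases h.mem_cases hF with hs | ⟨x, y, hxy, rfl, -, -⟩
      · exact Or.inl hs
      · exact Or.inr (by simpa using tri h bij bik bjk x y hxy hF)
    · rw [← prod_pair hij, ← prod_pair hik, ← prod_pair hjk, ← wt_singleton {j, k}]
      exact (wt_insert_le _).trans (Nat.add_le_add_left (wt_insert_le _) _)
  have t1 := tot h bij bik bjk
  have t2 := tot h.symm aij aik ajk
  have s1 := h.sum_erase_le hi (E := w i * w j + (w i * w k + w j * w k)) (by omega)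
  have s2 := h.le_rare hi (h.le_link hi {j, k} (by simp [hij, hik]) (by
    simp [aij, aik])) (h.deletion_le i {{j, k}} (by
      intro x y hxy hA hxi hyi
      rw [mem_singleton]
      rcases tri h bij bik bjk x y hxy hA with he | he | he
      · have : i ∈ ({x, y} : Finset α) := by rw [he]; simp
        simp only [mem_insert, mem_singleton] at this
        tauto
      · have : i ∈ ({x, y} : Finset α) := by rw [he]; simp
        simp only [mem_insert, mem_singleton] at this
        tauto
      · exact he))
  rw [sum_pair hjk, wt_singleton, prod_pair hjk] at s2
  rw [sum_erase_eq hjT hij, ← add_sum_erase _ w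
    (show k ∈ (T.erase i).erase j by simp [hik.symm, hjk.symm, hkT])] at s1 s2
  generalize ∑ x ∈ ((T.erase i).erase j).erase k, w x = s at *
  have w1 := h.two_le i
  have w2 := h.two_le j
  have w3 := h.two_le k
  generalize w i = a at *
  generalize w j = b at *
  generalize w k = c at *
  have q1 : a * s ≤ b * c := by nlinarith
  have q2 : s ≤ b := by
    have : a * s ≤ a * b := by nlinarith
    exact le_of_mul_le_mul_left this (by omega)
  have q3 : 2 * a ≤ a ^ 2 := by nlinarith
  have q4 : 4 ≤ a ^ 2 := by nlinarith
  have q5 : b * c + 2 * b ≤ a ^ 2 * b := by nlinarith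
  have q6 : 4 * c ≤ a ^ 2 * c := Nat.mul_le_mul_right _ q4
  nlinarith

end IsGraphOpt

end Graphs

/-! ### Cross-intersecting graphs: disjoint edges, and conclusion for graphs. -/

section Matchings

variable {α : Type*} [DecidableEq α] {w : α → ℕ} {𝒜 ℬ : Finset (Finset α)} {T : Finset α}
  {r : ℕ} {i j k l : α}

namespace IsGraphOpt

lemma pair_eq_of_matching (h : IsGraphOpt w T r 𝒜 ℬ) (hij : i ≠ j) (hik : i ≠ k) (hil : i ≠ l)
    (hjk : j ≠ k) (hjl : j ≠ l) (hkl : k ≠ l) (bik : {i, k} ∈ ℬ) (bjl : {j, l} ∈ ℬ) {x y : α}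
    (hxy : x ≠ y) (hA : {x, y} ∈ 𝒜) :
    {x, y} = ({i, j} : Finset α) ∨ {x, y} = ({k, l} : Finset α) ∨
      {x, y} = ({i, l} : Finset α) ∨ {x, y} = ({j, k} : Finset α) := by
  have h1 := h.meet hxy hik hA bik
  have h2 := h.meet hxy hjl hA bjl
  grind

lemma sum_erase_eq_three (hij : i ≠ j) (hik : i ≠ k) (hil : i ≠ l) (hjk : j ≠ k) (hjl : j ≠ l)
    (hkl : k ≠ l) (hj : j ∈ T) (hk : k ∈ T) (hl : l ∈ T) :
    ∑ x ∈ T.erase i, w x =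
      w j + w k + w l + ∑ x ∈ (((T.erase i).erase j).erase k).erase l, w x := by
  rw [sum_erase_eq hj hij,
    ← add_sum_erase _ w (show k ∈ (T.erase i).erase j by simp [hik.symm, hjk.symm, hk]),
    ← add_sum_erase _ w (show l ∈ ((T.erase i).erase j).erase k by
      simp [hil.symm, hjl.symm, hkl.symm, hl])]
  ring

/-- Without `{i, l}`, the only pair of `𝒜` that can avoid `j` is `{k, l}`. The assumed order of the
weights makes it too light for `j` to be rare. -/
lemma not_path (h : IsGraphOpt w T r 𝒜 ℬ) (hij : i ≠ j) (hik : i ≠ k) (hil : i ≠ l)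
    (hjk : j ≠ k) (hjl : j ≠ l) (hkl : k ≠ l) (aij : {i, j} ∈ 𝒜) (ajk : {j, k} ∈ 𝒜)
    (bik : {i, k} ∈ ℬ) (bjl : {j, l} ∈ ℬ) (nil : {i, l} ∉ 𝒜)
    (hsum : ∑ x ∈ T.erase j, w x = w i + w k + w l) (hl : w l ≤ w i) (hk : w k ≤ w j) :
    False := by
  have hj : j ∈ T := h.mem_left ajk
  have s2 := h.le_rare hj (h.le_link hj {i, k} (by simp [hij.symm, hjk]) (by
    simp [ajk, pair_comm j i, aij])) (h.deletion_le j {{k, l}} (by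
      intro x y hxy hA hxj hyj
      rw [mem_singleton]
      have hx : ∀ z : α, {x, y} = ({j, z} : Finset α) → False := fun z he => by
        have : j ∈ ({x, y} : Finset α) := by rw [he]; simp
        simp only [mem_insert, mem_singleton] at this
        tauto
      rcases h.pair_eq_of_matching hij hik hil hjk hjl hkl bik bjl hxy hA with he | he | he | he
      · exact (hx i (by rw [he, pair_comm])).elim
      · exact he
      · exact absurd (he ▸ hA) nil
      · exact (hx k he).elim))
  rw [sum_pair hik, wt_singleton, prod_pair hkl, hsum] at s2
  have w1 := h.two_le i
  have w2 := h.two_le j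
  have w3 := h.two_le k
  generalize w i = a at *
  generalize w j = b at *
  generalize w k = c at *
  generalize w l = d at *
  have q1 : 2 * b ≤ b ^ 2 := by nlinarith
  have q2 : 4 ≤ b ^ 2 := by nlinarith
  have q3 : c * d ≤ b * a := Nat.mul_le_mul hk hl
  have q4 : 2 * a ≤ b * a := Nat.mul_le_mul_right _ w2
  have q5 : 2 * b * a ≤ b ^ 2 * a := Nat.mul_le_mul_right _ q1
  have q6 : 4 * c ≤ b ^ 2 * c := Nat.mul_le_mul_right _ q2
  nlinarith

lemma wt_le_of_matching (h : IsGraphOpt w T r 𝒜 ℬ) (hij : i ≠ j) (hik : i ≠ k) (hil : i ≠ l)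
    (hjk : j ≠ k) (hjl : j ≠ l) (hkl : k ≠ l) (bik : {i, k} ∈ ℬ) (bjl : {j, l} ∈ ℬ) :
    wt w 𝒜 ≤ 1 + ∑ x ∈ T, w x + (w i * w j + (w k * w l +
      ((if {i, l} ∈ 𝒜 then w i * w l else 0) + if {j, k} ∈ 𝒜 then w j * w k else 0))) := by
  refine (wt_le (insert {i, j} (insert {k, l} ((if {i, l} ∈ 𝒜 then {{i, l}} else ∅) ∪
    if {j, k} ∈ 𝒜 then {{j, k}} else ∅))) fun F hF => ?_).trans (Nat.add_le_add_left ?_ _)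
  · rw [mem_union]
    rcases h.mem_cases hF with hs | ⟨x, y, hxy, rfl, -, -⟩
    · exact Or.inl hs
    · right
      simp only [mem_insert, mem_union]
      rcases h.pair_eq_of_matching hij hik hil hjk hjl hkl bik bjl hxy hF with he | he | he | he
      · exact Or.inl he
      · exact Or.inr (Or.inl he)
      · rw [he] at hF ⊢
        simp [hF]
      · rw [he] at hF ⊢
        simp [hF]
  · rw [← prod_pair hij, ← prod_pair hkl, ← prod_pair hil, ← prod_pair hjk]
    refine (wt_insert_le _).trans (Nat.add_le_add_left ((wt_insert_le _).trans
      (Nat.add_le_add_left (wt_union_le.trans (le_of_eq ?_)) _)) _)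
    congr 1 <;> split_ifs <;> simp [wt_singleton]

/-- Without `{j, k}`, the only pair of `𝒜` that can avoid `i` is `{k, l}`, too light for the
heaviest point `i` to be rare. -/
lemma pair_mem_of_matching (h : IsGraphOpt w T r 𝒜 ℬ) (hij : i ≠ j) (hik : i ≠ k) (hil : i ≠ l)
    (hjk : j ≠ k) (hjl : j ≠ l) (hkl : k ≠ l) (aij : {i, j} ∈ 𝒜)
    (bik : {i, k} ∈ ℬ) (bjl : {j, l} ∈ ℬ) (hj : w j ≤ w i) (hk : w k ≤ w i) (hl : w l ≤ w i)
    (hsum : ∑ x ∈ T.erase i, w x = w j + w k + w l) : {j, k} ∈ 𝒜 := by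
  by_contra njk
  have hi : i ∈ T := h.mem_left aij
  have s2 := h.le_rare hi (h.le_link hi {j} (by simp [hij]) (by
    simp [aij])) (h.deletion_le i {{k, l}} (by
      intro x y hxy hA hxj hyj
      rw [mem_singleton]
      have hx : ∀ z : α, {x, y} = ({i, z} : Finset α) → False := fun z he => by
        have : i ∈ ({x, y} : Finset α) := by rw [he]; simp
        simp only [mem_insert, mem_singleton] at this
        tauto
      rcases h.pair_eq_of_matching hij hik hil hjk hjl hkl bik bjl hxy hA with he | he | he | he
      · exact (hx _ he).elim
      · exact he
      · exact (hx _ he).elim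
      · exact absurd (he ▸ hA) njk))
  rw [sum_singleton, wt_singleton, prod_pair hkl, hsum] at s2
  have w1 := h.two_le i
  have w2 := h.two_le j
  generalize w i = a at *
  generalize w j = b at *
  generalize w k = c at *
  generalize w l = d at *
  have q1 : c * d ≤ a * a := Nat.mul_le_mul hk hl
  have q2 : 2 * a ≤ a * a := Nat.mul_le_mul_right _ w1
  have q3 : (a * a - 1) * 2 ≤ (a * a - 1) * b := Nat.mul_le_mul_left _ w2
  obtain ⟨q, hq⟩ : ∃ q, a * a = q + 1 := ⟨a * a - 1, by omega⟩
  rw [sq, hq] at s2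
  rw [hq] at q1 q2 q3
  simp only [Nat.add_sub_cancel] at q3
  nlinarith

/-- The total weight of the pairs is at most twice that of a star at `i` on the four points, so
`sum_erase_le` leaves no room in `T` for a fifth point. Then `{j, k}` lies in both families, hence
`{i, l}` in neither, and `not_path` applies to one of them. -/
lemma not_matchings (h : IsGraphOpt w T r 𝒜 ℬ) (hij : i ≠ j) (hik : i ≠ k) (hil : i ≠ l)
    (hjk : j ≠ k) (hjl : j ≠ l) (hkl : k ≠ l) (aij : {i, j} ∈ 𝒜) (akl : {k, l} ∈ 𝒜)
    (bik : {i, k} ∈ ℬ) (bjl : {j, l} ∈ ℬ) (hj : w j ≤ w i) (hk : w k ≤ w i) (hl : w l ≤ w i) :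
    False := by
  have hi : i ∈ T := h.mem_left aij
  have hjT : j ∈ T := h.symm.mem_left bjl
  have hkT : k ∈ T := h.mem_left akl
  have hlT : l ∈ T := h.mem_left (i := l) (j := k) (by rwa [pair_comm])
  have t1 := h.wt_le_of_matching hij hik hil hjk hjl hkl bik bjl
  have t2 := h.symm.wt_le_of_matching hik hij hil hjk.symm hkl hjl aij akl
  rw [pair_comm k j] at t2
  -- The diagonals `{i, l}` and `{j, k}` are disjoint, so they cannot lie in opposite families; this
  -- limits the cases in `hE`.
  have x1 : {i, l} ∈ 𝒜 → {j, k} ∉ ℬ := fun p q => by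
    rcases h.meet hil hjk p q with e | e | e | e
    exacts [hij e, hik e, hjl e.symm, hkl e.symm]
  have x2 : {i, l} ∈ ℬ → {j, k} ∉ 𝒜 := fun p q => by
    rcases h.symm.meet hil hjk p q with e | e | e | e
    exacts [hij e, hik e, hjl e.symm, hkl e.symm]
  have hE : wt w 𝒜 + wt w ℬ ≤ 2 * (1 + ∑ x ∈ T, w x) + 2 * (w i * (w j + w k + w l)) := by
    have e1 : w j * w k ≤ w i * w k := Nat.mul_le_mul_right _ hj
    have e2 : w j * w l ≤ w i * w l := Nat.mul_le_mul_right _ hj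
    have e3 : w k * w l ≤ w i * w l := Nat.mul_le_mul_right _ hk
    have e4 : w j * w k ≤ w i * w j := by rw [mul_comm]; exact Nat.mul_le_mul_right _ hk
    have e5 : w j * w l ≤ w i * w j := by rw [mul_comm]; exact Nat.mul_le_mul_right _ hl
    have e6 : w k * w l ≤ w i * w k := by rw [mul_comm]; exact Nat.mul_le_mul_right _ hl
    have e7 : w k * w j = w j * w k := mul_comm _ _
    have e8 := Nat.zero_le (w i * w l)
    have e9 := Nat.zero_le (w j * w k)
    rw [mul_add, mul_add]
    split_ifs at t1 t2 <;> first | linarith | (exfalso; tauto)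
  have hs := h.sum_erase_le hi hE
  have e := sum_erase_eq_three (w := w) hij hik hil hjk hjl hkl hjT hkT hlT
  rw [e, mul_add] at hs
  have w1 := h.two_le i
  have hs0 : ∑ x ∈ (((T.erase i).erase j).erase k).erase l, w x = 0 := by
    by_contra hne
    have := Nat.mul_pos (show 0 < w i by omega) (Nat.pos_of_ne_zero hne)
    omega
  rw [hs0, add_zero] at e
  have ajk := h.pair_mem_of_matching hij hik hil hjk hjl hkl aij bik bjl hj hk hl e
  have bkj := h.symm.pair_mem_of_matching hik hij hil hjk.symm hkl hjl bik aij akl hk hj hl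
    (by rw [e]; ring)
  have hT := add_sum_erase T w hi
  rcases le_total (w k) (w j) with hle | hle
  · refine h.not_path hij hik hil hjk hjl hkl aij ajk bik bjl (fun p => x1 p ?_) ?_ hl hle
    · rwa [pair_comm]
    · have := add_sum_erase T w hjT
      omega
  · refine h.symm.not_path hik hij hil hjk.symm hkl hjl bik bkj aij akl (fun p => x2 p ajk) ?_
      hl hle
    have := add_sum_erase T w hkT
    omega

/-- A graph with an edge that is not a star has a triangle or two disjoint edges. -/
lemma triangle_or_matching (hB : ∃ F ∈ 𝒜, #F = 2) (hT : ∀ F ∈ 𝒜, F ⊆ T)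
    (hns : ∀ i ∈ T, ∃ x y, x ≠ y ∧ {x, y} ∈ 𝒜 ∧ x ≠ i ∧ y ≠ i) :
    (∃ i j k, i ≠ j ∧ i ≠ k ∧ j ≠ k ∧ {i, j} ∈ 𝒜 ∧ {i, k} ∈ 𝒜 ∧ {j, k} ∈ 𝒜) ∨
    (∃ i j k l, i ≠ j ∧ i ≠ k ∧ i ≠ l ∧ j ≠ k ∧ j ≠ l ∧ k ≠ l ∧ {i, j} ∈ 𝒜 ∧ {k, l} ∈ 𝒜) := by
  have avoid : ∀ i j, i ≠ j → {i, j} ∈ 𝒜 →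
      (∃ k, k ≠ i ∧ k ≠ j ∧ {j, k} ∈ 𝒜) ∨
      (∃ k l, i ≠ k ∧ i ≠ l ∧ j ≠ k ∧ j ≠ l ∧ k ≠ l ∧ {k, l} ∈ 𝒜) := by
    intro i j hij hm
    obtain ⟨x, y, hxy, hm', hx, hy⟩ := hns i (hT _ hm (by simp))
    by_cases h1 : x = j
    · subst h1
      exact Or.inl ⟨y, hy, hxy.symm, hm'⟩
    by_cases h2 : y = j
    · subst h2
      exact Or.inl ⟨x, hx, hxy, by rwa [pair_comm]⟩
    exact Or.inr ⟨x, y, hx.symm, hy.symm, Ne.symm h1, Ne.symm h2, hxy, hm'⟩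
  obtain ⟨F, hF, hc⟩ := hB
  obtain ⟨i, j, hij, rfl⟩ := card_eq_two.1 hc
  rcases avoid i j hij hF with ⟨k, hki, hkj, hjk⟩ | ⟨k, l, h1, h2, h3, h4, h5, h6⟩
  swap
  · exact Or.inr ⟨i, j, k, l, hij, h1, h2, h3, h4, h5, hF, h6⟩
  rcases avoid j i hij.symm (by rwa [pair_comm]) with
    ⟨l, hlj, hli, hil⟩ | ⟨k, l, h1, h2, h3, h4, h5, h6⟩
  swap
  · exact Or.inr ⟨i, j, k, l, hij, h3, h4, h1, h2, h5, hF, h6⟩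
  by_cases hkl : k = l
  · subst hkl
    exact Or.inl ⟨i, j, k, hij, hki.symm, hkj.symm, hF, hil, hjk⟩
  · exact Or.inr ⟨i, l, j, k, hli.symm, hij, hki.symm, hlj, Ne.symm hkl, hkj.symm, hil, hjk⟩

lemma exists_avoiding (h : IsGraphOpt w T r 𝒜 ℬ) (hB : ∃ F ∈ ℬ, #F = 2) :
    ∀ i ∈ T, ∃ x y, x ≠ y ∧ {x, y} ∈ ℬ ∧ x ≠ i ∧ y ≠ i := by
  intro i hi
  by_contra hn
  push Not at hn
  refine h.not_star hi hB fun x y hxy hm => ?_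
  by_contra hne
  push Not at hne
  exact hne.2 (hn x y hxy hm hne.1)

/-- A pair of `ℬ` meeting all three edges of a triangle is one of these edges. As `ℬ` is not a star,
it has an edge avoiding each vertex, hence the whole triangle. -/
lemma not_triangle_left (h : IsGraphOpt w T r 𝒜 ℬ) (hB : ∃ F ∈ ℬ, #F = 2) (hij : i ≠ j)
    (hik : i ≠ k) (hjk : j ≠ k) (aij : {i, j} ∈ 𝒜) (aik : {i, k} ∈ 𝒜) (ajk : {j, k} ∈ 𝒜) :
    False := by
  have mem : ∀ {i j k : α}, i ≠ j → i ≠ k → j ≠ k → {i, j} ∈ 𝒜 → {i, k} ∈ 𝒜 → {j, k} ∈ 𝒜 →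
      {j, k} ∈ ℬ := by
    intro i j k hij hik hjk aij aik ajk
    obtain ⟨x, y, hxy, hm, hx, hy⟩ := h.exists_avoiding hB i (h.mem_left aij)
    have h1 := h.symm.meet hxy hij hm aij
    have h2 := h.symm.meet hxy hik hm aik
    have h3 := h.symm.meet hxy hjk hm ajk
    have : {j, k} = ({x, y} : Finset α) := by grind
    rwa [this]
  have key : ∀ {i j k : α}, i ≠ j → i ≠ k → j ≠ k → {i, j} ∈ 𝒜 → {i, k} ∈ 𝒜 → {j, k} ∈ 𝒜 →
      w j ≤ w i → w k ≤ w i → False := by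
    intro i j k hij hik hjk aij aik ajk hj hk
    refine h.not_triangle hij hik hjk aij aik ajk ?_ ?_ (mem hij hik hjk aij aik ajk) hj hk
    · exact mem hik.symm hjk.symm hij (by rwa [pair_comm]) (by rwa [pair_comm]) aij
    · exact mem hij.symm hjk hik (by rwa [pair_comm]) ajk aik
  have aji : {j, i} ∈ 𝒜 := by rwa [pair_comm]
  have aki : {k, i} ∈ 𝒜 := by rwa [pair_comm]
  have akj : {k, j} ∈ 𝒜 := by rwa [pair_comm]
  rcases le_total (w j) (w i) with h1 | h1
  · rcases le_total (w k) (w i) with h2 | h2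
    · exact key hij hik hjk aij aik ajk h1 h2
    · exact key hik.symm hjk.symm hij aki akj aij h2 (h1.trans h2)
  · rcases le_total (w k) (w j) with h2 | h2
    · exact key hij.symm hjk hik aji ajk aik h1 h2
    · exact key hik.symm hjk.symm hij aki akj aij (h1.trans h2) h2

lemma not_two_matchings (h : IsGraphOpt w T r 𝒜 ℬ) (hij : i ≠ j) (hik : i ≠ k) (hil : i ≠ l)
    (hjk : j ≠ k) (hjl : j ≠ l) (hkl : k ≠ l) (aij : {i, j} ∈ 𝒜) (akl : {k, l} ∈ 𝒜)
    (bik : {i, k} ∈ ℬ) (bjl : {j, l} ∈ ℬ) : False := by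
  have aji : {j, i} ∈ 𝒜 := by rwa [pair_comm]
  have alk : {l, k} ∈ 𝒜 := by rwa [pair_comm]
  have bki : {k, i} ∈ ℬ := by rwa [pair_comm]
  have blj : {l, j} ∈ ℬ := by rwa [pair_comm]
  obtain ⟨m, hm, hmax⟩ := exists_max_image ({i, j, k, l} : Finset α) w (by simp)
  simp only [mem_insert, mem_singleton, forall_eq_or_imp, forall_eq] at hm hmax
  obtain ⟨mi, mj, mk, ml⟩ := hmax
  rcases hm with rfl | rfl | rfl | rfl
  · exact h.not_matchings hij hik hil hjk hjl hkl aij akl bik bjl mj mk ml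
  · exact h.not_matchings hij.symm hjl hjk hil hik hkl.symm aji alk bjl bik mi ml mk
  · exact h.not_matchings hkl hik.symm hjk.symm hil.symm hjl.symm hij akl aij bki blj ml mi mj
  · exact h.not_matchings hkl.symm hjl.symm hil.symm hjk.symm hik.symm hij.symm alk aji blj bki
      mk mj mi

/-- Once triangles are excluded, both graphs contain two disjoint edges; each edge of one matching
joins the two edges of the other, giving an alternating four-cycle. -/
lemma not_both_pairs (h : IsGraphOpt w T r 𝒜 ℬ) (hA : ∃ F ∈ 𝒜, #F = 2) (hB : ∃ F ∈ ℬ, #F = 2) :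
    False := by
  rcases triangle_or_matching hA h.opt.subset_left (h.symm.exists_avoiding hA) with
    ⟨i, j, k, hij, hik, hjk, aij, aik, ajk⟩ | ⟨i, j, k, l, hij, hik, hil, hjk, hjl, hkl, aij, akl⟩
  · exact h.not_triangle_left hB hij hik hjk aij aik ajk
  rcases triangle_or_matching hB h.opt.subset_right (h.exists_avoiding hB) with
    ⟨i, j, k, hij, hik, hjk, aij, aik, ajk⟩ | ⟨x, y, u, v, hxy, hxu, hxv, hyu, hyv, huv, bxy, buv⟩
  · exact h.symm.not_triangle_left hA hij hik hjk aij aik ajk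
  have h1 := h.meet hij hxy aij bxy
  have h2 := h.meet hkl hxy akl bxy
  have h3 := h.meet hij huv aij buv
  have h4 := h.meet hkl huv akl buv
  have : ({i, k} ∈ ℬ ∧ {j, l} ∈ ℬ) ∨ ({i, l} ∈ ℬ ∧ {j, k} ∈ ℬ) := by
    have byx : {y, x} ∈ ℬ := by rwa [pair_comm]
    have bvu : {v, u} ∈ ℬ := by rwa [pair_comm]
    grind
  rcases this with ⟨b1, b2⟩ | ⟨b1, b2⟩
  · exact h.not_two_matchings hij hik hil hjk hjl hkl aij akl b1 b2
  · exact h.not_two_matchings hij hil hik hjl hjk hkl.symm aij (by rwa [pair_comm]) b1 b2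

end IsGraphOpt

end Matchings

/-! ### Optimal pairs with at most three points of slack are balls with room to spare. -/

section Spread

variable {α : Type*} [DecidableEq α] {w : α → ℕ} {𝒜 ℬ : Finset (Finset α)} {T : Finset α}
  {r : ℕ}

/-- One of the radii `k`, `l` is at most one, and two supports of that size together with one of
the other size fit into `m` points, one of which is set apart. -/
def Spread (k l m : ℕ) : Prop := (k ≤ 1 ∧ 2 * k + l + 1 ≤ m) ∨ (l ≤ 1 ∧ 2 * l + k + 1 ≤ m)

namespace IsOpt

/-- The power set of `T` without its lightest point is strictly heavier than each family. -/
lemma not_radii_one_one (h : IsOpt w T 1 𝒜 ℬ) (hw : ∀ i, 2 ≤ w i) (hT : #T = 3)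
    (hA : 𝒜 ⊆ smallSets T) (hB : ℬ ⊆ smallSets T) : False := by
  obtain ⟨l, hl, hmin⟩ := exists_min_image T w (card_pos.1 (by omega))
  have hc : #(T.erase l) = 2 := by rw [card_erase_of_mem hl, hT]
  have hm := h.powerset_le (erase_subset l T) (by omega)
  have hA' := wt_mono (w := w) hA
  have hB' := wt_mono (w := w) hB
  obtain ⟨i, j, hij, he⟩ := card_eq_two.1 hc
  have hi : w l ≤ w i := hmin i (erase_subset l T (by rw [he]; simp))
  rw [wt_smallSets, ← add_sum_erase _ w hl, he, sum_pair hij] at hA' hB'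
  rw [he, prod_pair hij] at hm
  have h1 := Nat.mul_le_mul hA' hB'
  have w1 := hw i
  have w2 := hw j
  generalize w i = a at *
  generalize w j = b at *
  generalize w l = c at *
  have h2 : 1 + (c + (a + b)) < (1 + a) * (1 + b) := by nlinarith
  have h3 := Nat.mul_lt_mul'' h2 h2
  rw [sq] at hm
  omega

/-- Let `Q` be the weight of the power set of `T` without its lightest point. Then `𝒜` weighs at
most `Q / 2` and `ℬ` less than `2 * Q`, so using the power set twice is better. -/
lemma not_radii_one_two (h : IsOpt w T 1 𝒜 ℬ) (hw : ∀ i, 2 ≤ w i) (hT : #T = 4)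
    (hA : 𝒜 ⊆ smallSets T) (hB : ∀ G ∈ ℬ, #G ≤ 2) : False := by
  obtain ⟨l, hl, hmin⟩ := exists_min_image T w (card_pos.1 (by omega))
  have hc : #(T.erase l) = 3 := by rw [card_erase_of_mem hl, hT]
  have hm := h.powerset_le (erase_subset l T) (by omega)
  have hA' := wt_mono (w := w) hA
  have hB' := wt_split (w := w) l ℬ
  have hB0 : wt w (ℬ.nonMemberSubfamily l) ≤ wt w (T.erase l).powerset := wt_mono fun F hF => by
    rw [mem_nonMemberSubfamily] at hF
    exact mem_powerset.2 (subset_erase.2 ⟨h.subset_right F hF.1, hF.2⟩)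
  have hB1 : wt w (ℬ.memberSubfamily l) ≤ wt w (smallSets (T.erase l)) := wt_mono fun F hF => by
    rw [mem_memberSubfamily] at hF
    have := hB _ hF.1
    rw [card_insert_of_notMem hF.2] at this
    exact mem_smallSets.2 ⟨subset_erase.2
      ⟨(subset_insert _ _).trans (h.subset_right _ hF.1), hF.2⟩, by omega⟩
  obtain ⟨i, j, k, hij, hik, hjk, he⟩ := card_eq_three.1 hc
  have hi : w l ≤ w i := hmin i (erase_subset l T (by rw [he]; simp))
  have hj : w l ≤ w j := hmin j (erase_subset l T (by rw [he]; simp))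
  have hk : w l ≤ w k := hmin k (erase_subset l T (by rw [he]; simp))
  rw [wt_smallSets, ← add_sum_erase _ w hl] at hA'
  rw [wt_powerset] at hB0
  rw [wt_smallSets] at hB1
  rw [he, sum_insert (by simp [hij, hik]), sum_pair hjk] at hA' hB1
  rw [he, prod_insert (by simp [hij, hik]), prod_pair hjk] at hm hB0
  have hB2 : wt w ℬ ≤ (1 + w i) * ((1 + w j) * (1 + w k)) +
      w l * (1 + (w i + (w j + w k))) := by
    rw [hB']
    exact Nat.add_le_add hB0 (Nat.mul_le_mul_left _ hB1)
  have w1 := hw i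
  have w2 := hw j
  have w3 := hw k
  have hpos : 0 < wt w ℬ := h.wt_right_pos (by omega)
  generalize wt w 𝒜 = A at *
  generalize wt w ℬ = B at *
  generalize w i = a at *
  generalize w j = b at *
  generalize w k = c at *
  generalize w l = d at *
  have e1 : a * 2 ≤ a * b := Nat.mul_le_mul_left a w2
  have e2 : b * 2 ≤ b * c := Nat.mul_le_mul_left b w3
  have e3 : 2 * c ≤ a * c := Nat.mul_le_mul_right c w1
  have e4 : d * a ≤ b * a := Nat.mul_le_mul_right a hj
  have e5 : d * b ≤ c * b := Nat.mul_le_mul_right b hk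
  have e6 : d * c ≤ a * c := Nat.mul_le_mul_right c hi
  have e7 : a * 2 * 2 ≤ a * b * c := Nat.mul_le_mul (Nat.mul_le_mul_left a w2) w3
  have hQ : (1 + a) * ((1 + b) * (1 + c)) =
      1 + a + b + c + a * b + a * c + b * c + a * b * c := by ring
  have q1 : 2 * A ≤ (1 + a) * ((1 + b) * (1 + c)) := by rw [hQ]; linarith
  have q2 : B < 2 * ((1 + a) * ((1 + b) * (1 + c))) := by
    rw [hQ] at hB2 ⊢
    linarith
  clear hQ hB2 hA' hB' hB0 hB1
  have hQ0 : 0 < (1 + a) * ((1 + b) * (1 + c)) := by positivity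
  generalize (1 + a) * ((1 + b) * (1 + c)) = Q at *
  have q3 : 2 * A * B < Q * (2 * Q) :=
    lt_of_le_of_lt (Nat.mul_le_mul_right _ q1) (Nat.mul_lt_mul_of_pos_left q2 hQ0)
  linarith

lemma exists_isBallPair_spread (h : IsOpt w T r 𝒜 ℬ) (hw : ∀ i, 2 ≤ w i) (hr1 : 1 ≤ r)
    (hr : r ≤ #T) (hd : #T ≤ r + 3) (hfree : ∀ i ∈ T, ¬ (FreePoint 𝒜 i ∧ FreePoint ℬ i)) :
    ∃ U k l, IsBallPair T U r k l 𝒜 ℬ ∧ Spread k l #U := by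
  have hw1 : ∀ i, 1 ≤ w i := fun i => one_le_two.trans (hw i)
  have inter_le : ∀ (F : Finset α), #(F ∩ T) ≤ #F := fun F => card_le_card inter_subset_left
  unfold Spread
  by_cases hd2 : #T ≤ r + 2
  · obtain ⟨U, k, l, hb⟩ := h.exists_isBallPair hw1 hr hd2
    refine ⟨U, k, l, hb, ?_⟩
    have hc := hb.card
    have hU := card_le_card hb.subset
    by_contra hn
    -- The radii sum to at most two; a zero radius always leaves room, and so do radii `1, 1` when
    -- `2 ≤ r`.
    have h1 : k = 1 ∧ l = 1 ∧ r = 1 := by omega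
    obtain ⟨rfl, rfl, rfl⟩ := h1
    have hUT : U = T := eq_of_subset_of_card_le hb.subset (by omega)
    subst hUT
    have hs : setBall U U 1 ⊆ smallSets U := fun F hF => by
      rw [mem_setBall] at hF
      rw [inter_eq_left.2 hF.1] at hF
      exact mem_smallSets.2 hF
    exact h.not_radii_one_one hw (by omega) (hb.left ▸ hs) (hb.right ▸ hs)
  have hT : #T = r + 3 := by omega
  by_cases tb : ∀ G ∈ ℬ, G = ∅
  · exact ⟨T, _, _, h.isBallPair_of_trivial hw1 hr tb, by omega⟩
  by_cases ta : ∀ G ∈ 𝒜, G = ∅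
  · exact ⟨T, _, _, (h.symm.isBallPair_of_trivial hw1 hr ta).symm, by omega⟩
  push Not at ta tb
  have rare := fun i hi => (h.rare_or_freePoint hw1 hr hi).resolve_right (hfree i hi)
  have hR : IsRareOpt w T r 𝒜 ℬ :=
    ⟨h, hw, hT, hr1, fun i hi => (rare i hi).1, fun i hi => (rare i hi).2⟩
  have small : ∀ {𝒜 ℬ : Finset (Finset α)}, IsRareOpt w T r 𝒜 ℬ → (∃ G ∈ ℬ, G ≠ ∅) →
      ∀ F ∈ 𝒜, #F ≤ 2 := by
    intro 𝒜 ℬ hR hB F hF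
    have h1 := hR.opt.cross F hF ∅ (hR.opt.symm.empty_mem hw1 hr)
    rw [union_empty] at h1
    by_contra hlt
    exact hR.not_triple hF (by omega) hB
  have sA := small hR (by simpa only [nonempty_iff_ne_empty] using tb)
  have sB := small hR.symm (by simpa only [nonempty_iff_ne_empty] using ta)
  have hG : IsGraphOpt w T r 𝒜 ℬ := ⟨hR, sA, sB⟩
  have main : ∀ {𝒜 ℬ : Finset (Finset α)}, IsGraphOpt w T r 𝒜 ℬ → (¬ ∃ F ∈ 𝒜, #F = 2) →
      IsBallPair T T r 1 2 𝒜 ℬ ∧ 5 ≤ #T := by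
    intro 𝒜 ℬ hG hn
    push Not at hn
    have hA : ∀ F ∈ 𝒜, #F ≤ 1 := fun F hF => by
      have := hG.card_left F hF
      have := hn F hF
      omega
    refine ⟨hG.opt.isBallPair_of_subset hw1 hr Subset.rfl (by omega)
      (fun F hF => (inter_le F).trans (hA F hF))
      (fun F hF => (inter_le F).trans (hG.card_right F hF)), ?_⟩
    by_contra hlt
    obtain rfl : r = 1 := by omega
    exact hG.opt.not_radii_one_two hw (by omega)
      (fun F hF => mem_smallSets.2 ⟨hG.opt.subset_left F hF, hA F hF⟩) hG.card_right
  by_cases pA : ∃ F ∈ 𝒜, #F = 2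
  · by_cases pB : ∃ F ∈ ℬ, #F = 2
    · exact (hG.not_both_pairs pA pB).elim
    · obtain ⟨hb, h5⟩ := main hG.symm pB
      exact ⟨T, 2, 1, hb.symm, by omega⟩
  · obtain ⟨hb, h5⟩ := main hG pA
    exact ⟨T, 1, 2, hb, by omega⟩

end IsOpt

end Spread

open Function

/-! ### Shifting one value of a coordinate. -/

section Shift

variable {n : ℕ} {p : Fin n → ℕ} {A B : Finset (Vec p)} {c x y : Vec p} {i j : Fin n}
  {v : Fin (p i)} {r : ℕ}

/-- The number of coordinates other than `i` in which `x` and `y` differ. -/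
def offDist (i : Fin n) (x y : Vec p) : ℕ := #(univ.filter fun j => j ≠ i ∧ x j ≠ y j)

lemma hammingDist_eq_offDist (i : Fin n) (x y : Vec p) :
    hammingDist x y = offDist i x y + if x i = y i then 0 else 1 := by
  unfold hammingDist offDist
  split_ifs with h
  · rw [add_zero]
    congr 1
    ext j
    simp only [mem_filter, mem_univ, true_and]
    exact ⟨fun hj => ⟨fun e => hj (e ▸ h), hj⟩, And.right⟩
  · rw [← card_insert_of_notMem (show i ∉ _ by simp)]
    congr 1
    ext j
    simp only [mem_filter, mem_univ, true_and, mem_insert]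
    by_cases hj : j = i
    · subst hj; simpa using h
    · simp [hj]

@[simp] lemma offDist_update_left (a : Fin (p i)) : offDist i (update x i a) y = offDist i x y := by
  unfold offDist
  congr 1
  ext j
  by_cases hj : j = i <;> simp [hj]

@[simp] lemma offDist_update_right (a : Fin (p i)) :
    offDist i x (update y i a) = offDist i x y := by
  unfold offDist
  congr 1
  ext j
  by_cases hj : j = i <;> simp [hj]

/-- The effect of the shift of value `v` to value `c i` in coordinate `i` on a vector. -/
def shiftVec (c : Vec p) (i : Fin n) (v : Fin (p i)) (A : Finset (Vec p)) (x : Vec p) : Vec p :=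
  if x i = v ∧ update x i (c i) ∉ A then update x i (c i) else x

/-- The shift of value `v` to value `c i` in coordinate `i`. -/
def shift (c : Vec p) (i : Fin n) (v : Fin (p i)) (A : Finset (Vec p)) : Finset (Vec p) :=
  A.image (shiftVec c i v A)

lemma mem_shift (hv : v ≠ c i) : x ∈ shift c i v A ↔
    if x i = c i then x ∈ A ∨ update x i v ∈ A
    else if x i = v then x ∈ A ∧ update x i (c i) ∈ A else x ∈ A := by
  unfold shift
  rw [mem_image]
  constructor
  · rintro ⟨y, hy, rfl⟩
    unfold shiftVec
    by_cases h : y i = v ∧ update y i (c i) ∉ A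
    · rw [if_pos h]
      have : update (update y i (c i)) i v = y := by rw [update_idem, ← h.1, update_eq_self]
      simp [this, hy]
    · rw [if_neg h]
      split_ifs with h1 h2
      · exact Or.inl hy
      · exact ⟨hy, by tauto⟩
      · exact hy
  · unfold shiftVec
    split_ifs with h1 h2
    · intro h
      by_cases hx : x ∈ A
      · exact ⟨x, hx, if_neg fun hh : x i = v ∧ _ => hv (hh.1.symm.trans h1)⟩
      · have : update (update x i v) i (c i) = x := by rw [update_idem, ← h1, update_eq_self]
        exact ⟨update x i v, h.resolve_left hx, by rw [this, if_pos ⟨by simp, hx⟩]⟩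
    · intro h
      exact ⟨x, h.1, if_neg fun hh => hh.2 h.2⟩
    · intro h
      exact ⟨x, h, if_neg fun hh => h2 hh.1⟩

lemma card_shift (c : Vec p) (i : Fin n) (v : Fin (p i)) (A : Finset (Vec p)) :
    #(shift c i v A) = #A := by
  refine card_image_of_injOn fun x hx y hy hxy => ?_
  unfold shiftVec at hxy
  rw [mem_coe] at hx hy
  split_ifs at hxy with h1 h2 h2
  · have e := congrArg (fun z => update z i v) hxy
    simp only [update_idem] at e
    have ex : update x i v = x := by rw [← h1.1, update_eq_self]
    have ey : update y i v = y := by rw [← h2.1, update_eq_self]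
    rwa [ex, ey] at e
  · exact absurd (hxy ▸ hy) h1.2
  · exact absurd (hxy ▸ hx) h2.2
  · exact hxy

/-- The total distance of the members of `A` from `c`. -/
def potential (c : Vec p) (A : Finset (Vec p)) : ℕ := ∑ x ∈ A, hammingDist x c

lemma hammingDist_shiftVec (hv : v ≠ c i) :
    hammingDist (shiftVec c i v A x) c ≤ hammingDist x c ∧
      (shiftVec c i v A x ≠ x → hammingDist (shiftVec c i v A x) c < hammingDist x c) := by
  unfold shiftVec
  split_ifs with h
  · rw [hammingDist_eq_offDist i, hammingDist_eq_offDist i x]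
    simp [h.1, hv]
  · simp

lemma potential_shift_lt (hv : v ≠ c i) (h : shift c i v A ≠ A) :
    potential c (shift c i v A) < potential c A := by
  have hex : ∃ x ∈ A, shiftVec c i v A x ≠ x := by
    by_contra hn
    push Not at hn
    refine h ?_
    unfold shift
    rw [image_congr (g := id) fun x hx => hn x hx, image_id]
  obtain ⟨x, hx, hne⟩ := hex
  unfold potential
  rw [shift]
  refine lt_of_le_of_lt (sum_image_le_of_nonneg (fun _ _ => Nat.zero_le _)) ?_
  exact sum_lt_sum (fun y _ => (hammingDist_shiftVec hv).1) ⟨x, hx, (hammingDist_shiftVec hv).2 hne⟩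

lemma CrossInt.symm (h : CrossInt r A B) : CrossInt r B A := fun x hx y hy => by
  have := h y hy x hx
  rwa [RIntersecting, hammingDist_comm] at this

/-- The delicate case is a moved `y` against an unmoved `x`. If `x i ≠ v`, moving `y` away from `v`
does not increase the distance. If `x i = v`, then `x` stayed because its copy at `c i` was already
in `A`, and that copy differs at `i` from the preimage of `y`. -/
lemma CrossInt.shift (hv : v ≠ c i) (h : CrossInt r A B) :
    CrossInt r (shift c i v A) (shift c i v B) := by
  have key : ∀ {A : Finset (Vec p)} {x : Vec p}, x ∈ CrossIntersecting.shift c i v A →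
      (x ∈ A ∨ (x i = c i ∧ update x i v ∈ A)) ∧ (x i = v → update x i (c i) ∈ A) := by
    intro A x hx
    rw [mem_shift hv] at hx
    split_ifs at hx with h1 h2
    · exact ⟨by tauto, fun e => absurd (e ▸ h1) hv⟩
    · exact ⟨Or.inl hx.1, fun _ => hx.2⟩
    · exact ⟨Or.inl hx, fun e => absurd e h2⟩
  have mixed : ∀ {A B : Finset (Vec p)} {x y : Vec p}, CrossInt r A B → x ∈ A →
      (x i = v → update x i (c i) ∈ A) → y i = c i → update y i v ∈ B → hammingDist x y + r ≤ n := by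
    intro A B x y h hx hx' hy hy'
    have h1 := h _ hx _ hy'
    rw [RIntersecting, hammingDist_eq_offDist i] at h1
    rw [hammingDist_eq_offDist i]
    by_cases hxv : x i = v
    · have h2 := h _ (hx' hxv) _ hy'
      rw [RIntersecting, hammingDist_eq_offDist i] at h2
      simp only [offDist_update_left, offDist_update_right, update_self, if_neg hv.symm] at h2
      split_ifs <;> omega
    · simp only [offDist_update_right, update_self, if_neg hxv] at h1
      split_ifs <;> omega
  intro x hx y hy
  obtain ⟨hx1, hx2⟩ := key hx
  obtain ⟨hy1, hy2⟩ := key hy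
  rcases hx1 with hx1 | hx1 <;> rcases hy1 with hy1 | hy1
  · exact h x hx1 y hy1
  · exact mixed h hx1 hx2 hy1.1 hy1.2
  · have := mixed h.symm hy1 hy2 hx1.1 hx1.2
    rwa [hammingDist_comm] at this
  · have h1 := h _ hx1.2 _ hy1.2
    rw [RIntersecting, hammingDist_eq_offDist i] at h1 ⊢
    simp only [offDist_update_left, offDist_update_right, update_self, if_true] at h1
    rw [hx1.1, hy1.1, if_pos rfl]
    exact h1

lemma IsMaximalPair.shift (hv : v ≠ c i) (h : IsMaximalPair r A B) :
    IsMaximalPair r (shift c i v A) (shift c i v B) := by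
  refine ⟨h.1.shift hv, fun A' B' h' => ?_⟩
  rw [card_shift, card_shift]
  exact h.2 A' B' h'

lemma Irrelevant.mem_iff (h : Irrelevant A j) (hxy : ∀ k, k ≠ j → x k = y k) :
    x ∈ A ↔ y ∈ A :=
  ⟨h x y hxy, h y x fun k hk => (hxy k hk).symm⟩

lemma Irrelevant.shift (hv : v ≠ c i) (h : Irrelevant A j) : Irrelevant (shift c i v A) j := by
  intro x y hxy hx
  rw [mem_shift hv] at hx ⊢
  by_cases hij : i = j
  · subst hij
    have e : ∀ a, (update x i a ∈ A ↔ x ∈ A) ∧ (update y i a ∈ A ↔ x ∈ A) := fun a =>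
      ⟨h.mem_iff fun k hk => by simp [hk], h.mem_iff fun k hk => by simp [hk, hxy k hk]⟩
    have ey : y ∈ A ↔ x ∈ A := h.mem_iff fun k hk => (hxy k hk).symm
    simp only [e, ey, or_self, and_self, ite_self] at hx ⊢
    exact hx
  · have e : ∀ a, update x i a ∈ A ↔ update y i a ∈ A := fun a => h.mem_iff fun k hk => by
      by_cases hki : k = i
      · subst hki; simp
      · simp [hki, hxy k hk]
    rw [← hxy i hij]
    simpa only [e, h.mem_iff hxy] using hx

end Shift

/-! ### Monotone maximal pairs and their families of supports. -/

section Monotone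

variable {n : ℕ} {p : Fin n → ℕ} {A B : Finset (Vec p)} {c x y : Vec p} {r : ℕ}

/-- `A` is closed under resetting coordinates to their value in `c`. -/
def IsMono (c : Vec p) (A : Finset (Vec p)) : Prop := ∀ x ∈ A, ∀ i, update x i (c i) ∈ A

lemma isMono_of_shift_eq (h : ∀ i v, v ≠ c i → shift c i v A = A) : IsMono c A := by
  intro x hx i
  by_cases hxi : x i = c i
  · rwa [← hxi, update_eq_self]
  · have h1 := hx
    rw [← h i (x i) hxi, mem_shift hxi, if_neg hxi, if_pos rfl] at h1
    exact h1.2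

lemma IsMono.reset_mem (h : IsMono c A) (hx : x ∈ A) (S : Finset (Fin n)) :
    (fun j => if j ∈ S then c j else x j) ∈ A := by
  induction S using Finset.induction_on with
  | empty => simpa using hx
  | insert i S _ ih =>
    have := h _ ih i
    convert this using 1
    ext j
    by_cases hj : j = i
    · subst hj; simp
    · simp [hj]

/-- The coordinates in which `x` differs from `c`. -/
def supp (c x : Vec p) : Finset (Fin n) := univ.filter fun i => x i ≠ c i

lemma mem_supp {i : Fin n} : i ∈ supp c x ↔ x i ≠ c i := by simp [supp]

/-- Resetting `x` to `c` wherever it agrees with `y` keeps it in `A` and makes its distance from `y`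
equal to the size of the union of supports. -/
lemma IsMono.card_supp_union_le (hA : IsMono c A) (h : CrossInt r A B) (hx : x ∈ A) (hy : y ∈ B) :
    #(supp c x ∪ supp c y) + r ≤ n := by
  have h1 := h _ (hA.reset_mem hx (univ.filter fun j => x j = y j)) _ hy
  rw [RIntersecting] at h1
  refine le_trans (Nat.add_le_add_right (le_of_eq ?_) r) h1
  unfold hammingDist
  congr 1
  ext j
  simp only [mem_union, mem_supp, mem_filter, mem_univ, true_and]
  by_cases hj : x j = y j
  · simp [hj, ne_comm]
  · simp only [hj, if_false]
    constructor
    · exact fun _ => hj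
    · intro _
      by_contra hn
      push Not at hn
      exact hj (hn.1.trans hn.2.symm)

lemma hammingDist_le_card_supp_union (c x y : Vec p) :
    hammingDist x y ≤ #(supp c x ∪ supp c y) := by
  refine card_le_card fun j hj => ?_
  simp only [mem_filter, mem_univ, true_and] at hj
  simp only [mem_union, mem_supp]
  by_contra hn
  push Not at hn
  exact hj (hn.1.trans hn.2.symm)

lemma card_supp_eq (c : Vec p) (F : Finset (Fin n)) :
    #(univ.filter fun x : Vec p => supp c x = F) = ∏ i ∈ F, (p i - 1) := by
  have : (univ.filter fun x : Vec p => supp c x = F) =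
      Fintype.piFinset fun i => if i ∈ F then {c i}ᶜ else {c i} := by
    ext x
    simp only [mem_filter, mem_univ, true_and, Fintype.mem_piFinset, Finset.ext_iff, mem_supp]
    refine forall_congr' fun i => ?_
    split_ifs with h <;> simp [h]
  rw [this, Fintype.card_piFinset]
  calc ∏ i, #(if i ∈ F then {c i}ᶜ else {c i}) = ∏ i, if i ∈ F then p i - 1 else 1 := by
        refine prod_congr rfl fun i _ => ?_
        split_ifs <;> simp [card_compl]
    _ = _ := by rw [prod_ite_mem, univ_inter]

lemma card_filter_supp_mem (c : Vec p) (𝒜 : Finset (Finset (Fin n))) :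
    #(univ.filter fun x : Vec p => supp c x ∈ 𝒜) = wt (fun i => p i - 1) 𝒜 := by
  rw [card_eq_sum_card_fiberwise (f := supp c) (t := 𝒜) (fun x hx => by simpa using hx)]
  refine sum_congr rfl fun F hF => ?_
  rw [← card_supp_eq c F]
  congr 1
  ext x
  simp only [mem_filter, mem_univ, true_and]
  exact ⟨And.right, fun h => ⟨h ▸ hF, h⟩⟩

lemma IsMaximalPair.card_pos_mul (h : IsMaximalPair r A B) (c : Vec p) (hr : r ≤ n) :
    0 < #A * #B := by
  have := h.2 {c} {c} (by
    intro x hx y hy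
    rw [mem_singleton] at hx hy
    subst hx hy
    simpa [RIntersecting] using hr)
  rwa [card_singleton, mul_one] at this

/-- A monotone maximal pair consists of all vectors whose supports lie in an optimal pair of set
families. -/
lemma IsMaximalPair.isOpt (h : IsMaximalPair r A B) (hr : r ≤ n) (hA : IsMono c A) :
    IsOpt (fun i => p i - 1) univ r (A.image (supp c)) (B.image (supp c)) ∧
      (∀ x, x ∈ A ↔ supp c x ∈ A.image (supp c)) ∧
      (∀ x, x ∈ B ↔ supp c x ∈ B.image (supp c)) := by
  have lift : ∀ 𝒜 ℬ : Finset (Finset (Fin n)), (∀ F ∈ 𝒜, ∀ G ∈ ℬ, #(F ∪ G) + r ≤ n) →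
      wt (fun i => p i - 1) 𝒜 * wt (fun i => p i - 1) ℬ ≤ #A * #B := by
    intro 𝒜 ℬ hc
    rw [← card_filter_supp_mem c, ← card_filter_supp_mem c]
    refine h.2 _ _ fun x hx y hy => ?_
    simp only [mem_filter, mem_univ, true_and] at hx hy
    exact (Nat.add_le_add_right (hammingDist_le_card_supp_union c x y) r).trans (hc _ hx _ hy)
  have hcr : ∀ F ∈ A.image (supp c), ∀ G ∈ B.image (supp c), #(F ∪ G) + r ≤ n := by
    intro F hF G hG
    obtain ⟨x, hx, rfl⟩ := mem_image.1 hF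
    obtain ⟨y, hy, rfl⟩ := mem_image.1 hG
    exact hA.card_supp_union_le h.1 hx hy
  have hle := lift _ _ hcr
  have sub : ∀ C : Finset (Vec p), C ⊆ univ.filter fun x => supp c x ∈ C.image (supp c) :=
    fun C x hx => by simpa using ⟨x, hx, rfl⟩
  have cA := card_le_card (sub A)
  have cB := card_le_card (sub B)
  have hpos := h.card_pos_mul c hr
  have pA : 0 < #A := pos_of_mul_pos_left hpos (Nat.zero_le _)
  have pB : 0 < #B := pos_of_mul_pos_right hpos (Nat.zero_le _)
  -- Taking all vectors with the supports that occur gives a cross-intersecting pair containing the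
  -- given one, so maximality forces equality. Only `A` needs to be monotone.
  have eA : A = univ.filter fun x => supp c x ∈ A.image (supp c) := by
    refine eq_of_subset_of_card_le (sub A) ?_
    rw [card_filter_supp_mem] at cA cB ⊢
    by_contra hlt
    nlinarith
  have eB : B = univ.filter fun x => supp c x ∈ B.image (supp c) := by
    refine eq_of_subset_of_card_le (sub B) ?_
    rw [card_filter_supp_mem] at cA cB ⊢
    by_contra hlt
    nlinarith
  refine ⟨⟨fun F _ => subset_univ F, fun F _ => subset_univ F, by simpa using hcr, ?_⟩, ?_, ?_⟩
  · intro 𝒜 ℬ _ _ hc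
    rw [card_fin] at hc
    rw [← card_filter_supp_mem c (A.image _), ← card_filter_supp_mem c (B.image _), ← eA, ← eB]
    exact lift 𝒜 ℬ hc
  · intro x
    conv_lhs => rw [eA]
    simp
  · intro x
    conv_lhs => rw [eB]
    simp

lemma exists_value_ne (hp : IsSizeVector p) (c : Vec p) : ∃ o : Vec p, ∀ i, o i ≠ c i := by
  have : ∀ i, ∃ a : Fin (p i), a ≠ c i := fun i => by
    have : Nontrivial (Fin (p i)) := Fin.nontrivial_iff_two_le.2 (hp i)
    exact exists_ne (c i)
  choose o ho using this
  exact ⟨o, ho⟩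

/-- As each `p i` is at least two, every set of coordinates is the support of some vector, so
irrelevance can be tested on supports. -/
lemma Irrelevant.freePoint (hp : IsSizeVector p) {i : Fin n} (h : Irrelevant A i)
    (hA : ∀ x, x ∈ A ↔ supp c x ∈ A.image (supp c)) : FreePoint (A.image (supp c)) i := by
  obtain ⟨o, ho⟩ := exists_value_ne hp c
  intro F
  set x : Vec p := fun j => if j ∈ insert i F then o j else c j with hx
  have h1 : supp c x = insert i F := by
    ext j
    rw [mem_supp, hx]
    by_cases hj : j ∈ insert i F
    · simp only [hj, if_true, iff_true]; exact ho j
    · simp only [hj, if_false, iff_false]; simp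
  have h2 : supp c (update x i (c i)) = F.erase i := by
    ext j
    rw [mem_supp, mem_erase]
    by_cases hj : j = i
    · subst hj; simp
    · rw [update_of_ne hj, ← mem_supp, h1]
      simp [hj]
  rw [← h1, ← h2, ← hA, ← hA]
  exact h.mem_iff fun k hk => by simp [hk]

/-- `A` and `B` are Hamming balls with the same centre and coordinates and with complementary
radii. -/
structure IsHammingPair (U : Finset (Fin n)) (x₀ : Vec p) (r k l : ℕ) (A B : Finset (Vec p)) :
    Prop where
  card : k + l + r = #U
  left : A = hammingBall U x₀ k
  right : B = hammingBall U x₀ l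

lemma IsHammingPair.symm {U : Finset (Fin n)} {k l : ℕ} (h : IsHammingPair U x r k l A B) :
    IsHammingPair U x r l k B A :=
  ⟨by rw [add_comm l]; exact h.card, h.right, h.left⟩

lemma IsHammingPair.isBall {U : Finset (Fin n)} {k l : ℕ} (h : IsHammingPair U x r k l A B) :
    IsBall A ∧ IsBall B := by
  have := h.card
  exact ⟨⟨U, x, k, by omega, h.left⟩, ⟨U, x, l, by omega, h.right⟩⟩

lemma IsBallPair.isHammingPair {U : Finset (Fin n)} {k l : ℕ}
    (h : IsBallPair univ U r k l (A.image (supp c)) (B.image (supp c)))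
    (hA : ∀ x, x ∈ A ↔ supp c x ∈ A.image (supp c))
    (hB : ∀ x, x ∈ B ↔ supp c x ∈ B.image (supp c)) : IsHammingPair U c r k l A B := by
  have key : ∀ x, supp c x ∩ U = U.filter fun i => x i ≠ c i := fun x => by
    ext i
    rw [mem_inter, mem_supp, mem_filter, and_comm]
  refine ⟨h.card, ?_, ?_⟩
  · ext x
    rw [hA, h.left, mem_setBall, key]
    simp [hammingBall]
  · ext x
    rw [hB, h.right, mem_setBall, key]
    simp [hammingBall]

/-- Properties of monotone maximal pairs reduce to those of optimal pairs of set families. -/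
lemma IsMaximalPair.exists_isHammingPair_of_isMono (hp : IsSizeVector p) {P : ℕ → ℕ → ℕ → Prop}
    {d : ℕ} (base : ∀ (T : Finset (Fin n)) (𝒜 ℬ : Finset (Finset (Fin n))),
      IsOpt (fun i => p i - 1) T r 𝒜 ℬ → r ≤ #T → #T ≤ r + d →
      (∀ i ∈ T, ¬ (FreePoint 𝒜 i ∧ FreePoint ℬ i)) →
      ∃ U k l, IsBallPair T U r k l 𝒜 ℬ ∧ P k l #U)
    (h : IsMaximalPair r A B) (hr : r ≤ n) (hA : IsMono c A)
    {R : Finset (Fin n)} (hR : #R ≤ r + d) (hirr : ∀ i ∉ R, Irrelevant A i ∧ Irrelevant B i) :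
    ∃ U k l, IsHammingPair U c r k l A B ∧ P k l #U := by
  obtain ⟨ho, mA, mB⟩ := h.isOpt hr hA
  obtain ⟨U, k, l, hb, hP⟩ := IsOpt.reduction
    (fun i => by have := hp i; omega) base _ univ R _ _ rfl ho (by simpa using hr) hR
    fun i _ hi => ⟨(hirr i hi).1.freePoint hp mA, (hirr i hi).2.freePoint hp mB⟩
  exact ⟨U, k, l, hb.isHammingPair mA mB, hP⟩

end Monotone

/-! ### Undoing a shift on a pair of balls. -/

section Unshift

variable {n : ℕ} {p : Fin n → ℕ} {A B : Finset (Vec p)} {c x y x₀ : Vec p} {i : Fin n}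
  {v : Fin (p i)} {r k l : ℕ} {U : Finset (Fin n)}

/-- The coordinates in `U`, other than `i`, in which `x` differs from `x₀`. -/
def offSupp (U : Finset (Fin n)) (x₀ : Vec p) (i : Fin n) (x : Vec p) : Finset (Fin n) :=
  (U.erase i).filter fun j => x j ≠ x₀ j

lemma mem_offSupp {j : Fin n} : j ∈ offSupp U x₀ i x ↔ (j ≠ i ∧ j ∈ U) ∧ x j ≠ x₀ j := by
  simp [offSupp]

@[simp] lemma offSupp_update (a : Fin (p i)) :
    offSupp U x₀ i (update x i a) = offSupp U x₀ i x := by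
  ext j
  by_cases hj : j = i <;> simp [mem_offSupp, hj]

@[simp] lemma offSupp_update_center (a : Fin (p i)) :
    offSupp U (update x₀ i a) i x = offSupp U x₀ i x := by
  ext j
  by_cases hj : j = i <;> simp [mem_offSupp, hj]

lemma mem_hammingBall_iff (hi : i ∈ U) :
    x ∈ hammingBall U x₀ k ↔ #(offSupp U x₀ i x) + (if x i = x₀ i then 0 else 1) ≤ k := by
  simp only [hammingBall, mem_filter, mem_univ, true_and]
  have e : (U.filter fun j => x j ≠ x₀ j) =
      if x i = x₀ i then offSupp U x₀ i x else insert i (offSupp U x₀ i x) := by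
    split_ifs with h <;> ext j <;> by_cases hj : j = i
    · subst hj; simp [mem_offSupp, h]
    · simp [mem_offSupp, hj]
    · subst hj; simp [hi, h]
    · simp [mem_offSupp, hj]
  rw [e]
  split_ifs
  · rfl
  · rw [card_insert_of_notMem (by simp [mem_offSupp])]

/-- A vector that was moved leaves its position at `v` vacant, so no vector moved if each vector at
`c i` still has its copy at `v`. -/
lemma shift_eq_self (hv : v ≠ c i)
    (h : ∀ x, x i = c i → x ∈ shift c i v A → update x i v ∈ shift c i v A) :
    shift c i v A = A := by
  ext x
  have hvc : update x i v ∈ shift c i v A ↔ update x i v ∈ A ∧ update x i (c i) ∈ A := by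
    rw [mem_shift hv, update_self, if_neg hv, if_pos rfl, update_idem]
  by_cases h1 : x i = c i
  · have e : update x i (c i) = x := by rw [← h1, update_eq_self]
    rw [e] at hvc
    constructor
    · exact fun hx => (hvc.1 (h x h1 hx)).2
    · intro hx
      rw [mem_shift hv, if_pos h1]
      exact Or.inl hx
  · by_cases h2 : x i = v
    · have e : update x i v = x := by rw [← h2, update_eq_self]
      rw [e] at hvc
      constructor
      · exact fun hx => (hvc.1 hx).1
      · intro hx
        have h3 := h (update x i (c i)) (by simp) (by
          rw [mem_shift hv, if_pos (by simp), update_idem, e]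
          exact Or.inr hx)
        rwa [update_idem, e] at h3
    · rw [mem_shift hv, if_neg h1, if_neg h2]

/-- If `i` lies outside `U` or the centre has another value than `c i` there, changing `c i` to `v`
cannot leave the ball. -/
lemma shift_eq_self_of_hammingBall (hv : v ≠ c i) (h : shift c i v A = hammingBall U x₀ k)
    (hi : ¬ (i ∈ U ∧ x₀ i = c i)) : shift c i v A = A := by
  refine shift_eq_self hv fun x hx hm => ?_
  rw [h] at hm ⊢
  simp only [hammingBall, mem_filter, mem_univ, true_and] at hm ⊢
  refine le_trans (card_le_card fun j hj => ?_) hm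
  rw [mem_filter] at hj ⊢
  by_cases hji : j = i
  · subst hji
    exact ⟨hj.1, fun e => hi ⟨hj.1, e ▸ hx⟩⟩
  · rwa [update_of_ne hji] at hj

/-- What the shifted family being a ball says about the original one. -/
lemma mem_of_shift_eq_hammingBall (hv : v ≠ c i) (h : shift c i v A = hammingBall U x₀ k)
    (hi : i ∈ U) (h0 : x₀ i = c i) (x : Vec p) :
    (#(offSupp U x₀ i x) ≤ k ↔ update x i (c i) ∈ A ∨ update x i v ∈ A) ∧
    (#(offSupp U x₀ i x) + 1 ≤ k ↔ update x i (c i) ∈ A ∧ update x i v ∈ A) ∧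
    (x i ≠ c i → x i ≠ v → (#(offSupp U x₀ i x) + 1 ≤ k ↔ x ∈ A)) := by
  have e : ∀ z, z ∈ hammingBall U x₀ k ↔ z ∈ shift c i v A := fun z => by rw [h]
  refine ⟨?_, ?_, fun h1 h2 => ?_⟩
  · have := e (update x i (c i))
    rw [mem_hammingBall_iff hi, mem_shift hv] at this
    simpa [h0] using this
  · have := e (update x i v)
    rw [mem_hammingBall_iff hi, mem_shift hv] at this
    simpa [h0, hv, and_comm] using this
  · have := e x
    rw [mem_hammingBall_iff hi, mem_shift hv, h0, if_neg h1, if_neg h1, if_neg h2] at this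
    exact this

/-- Only vectors with exactly `k` differences off `i` are undetermined by the shifted family; `hA`
places them at `c i`. -/
lemma eq_hammingBall_of_forall (hv : v ≠ c i) (h : shift c i v A = hammingBall U x₀ k)
    (hi : i ∈ U) (h0 : x₀ i = c i)
    (hA : ∀ x, #(offSupp U x₀ i x) = k → update x i (c i) ∈ A) : A = hammingBall U x₀ k := by
  ext x
  obtain ⟨h1, h2, h3⟩ := mem_of_shift_eq_hammingBall hv h hi h0 x
  have h4 := hA x
  rw [mem_hammingBall_iff hi, h0]
  by_cases e1 : x i = c i
  · have e : update x i (c i) = x := by rw [← e1, update_eq_self]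
    rw [if_pos e1, add_zero]
    rw [e] at h1 h2 h4
    rcases lt_trichotomy #(offSupp U x₀ i x) k with hlt | heq | hgt
    · exact ⟨fun _ => hlt.le, fun _ => (h2.1 hlt).1⟩
    · exact ⟨fun _ => heq.le, fun _ => h4 heq⟩
    · exact ⟨fun hx => h1.2 (Or.inl hx), fun hle => absurd hle (not_le.2 hgt)⟩
  · rw [if_neg e1]
    by_cases e2 : x i = v
    · have e : update x i v = x := by rw [← e2, update_eq_self]
      rw [e] at h1 h2
      constructor
      · intro hx
        have hle := h1.2 (Or.inr hx)
        rcases hle.eq_or_lt with heq | hlt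
        · exact h2.2 ⟨h4 heq, hx⟩
        · exact hlt
      · exact fun hle => (h2.1 hle).2
    · exact (h3 e1 e2).symm

lemma eq_hammingBall_update_of_forall (hv : v ≠ c i) (h : shift c i v A = hammingBall U x₀ k)
    (hi : i ∈ U) (h0 : x₀ i = c i)
    (hA : ∀ x, #(offSupp U x₀ i x) = k → update x i v ∈ A) :
    A = hammingBall U (update x₀ i v) k := by
  ext x
  obtain ⟨h1, h2, h3⟩ := mem_of_shift_eq_hammingBall hv h hi h0 x
  have h4 := hA x
  rw [mem_hammingBall_iff hi, offSupp_update_center, update_self]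
  by_cases e1 : x i = v
  · have e : update x i v = x := by rw [← e1, update_eq_self]
    rw [if_pos e1, add_zero]
    rw [e] at h1 h2 h4
    rcases lt_trichotomy #(offSupp U x₀ i x) k with hlt | heq | hgt
    · exact ⟨fun _ => hlt.le, fun _ => (h2.1 hlt).2⟩
    · exact ⟨fun _ => heq.le, fun _ => h4 heq⟩
    · exact ⟨fun hx => h1.2 (Or.inr hx), fun hle => absurd hle (not_le.2 hgt)⟩
  · rw [if_neg e1]
    by_cases e2 : x i = c i
    · have e : update x i (c i) = x := by rw [← e2, update_eq_self]
      rw [e] at h1 h2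
      constructor
      · intro hx
        have hle := h1.2 (Or.inl hx)
        rcases hle.eq_or_lt with heq | hlt
        · exact h2.2 ⟨hx, h4 heq⟩
        · exact hlt
      · exact fun hle => (h2.1 hle).1
    · exact (h3 e2 e1).symm

/-- `x` and `y` have disjoint supports in `U` off `i` and differ everywhere outside `U`. -/
def Opposite (U : Finset (Fin n)) (x₀ : Vec p) (i : Fin n) (x y : Vec p) : Prop :=
  (∀ j ∉ U, x j ≠ y j) ∧ Disjoint (offSupp U x₀ i x) (offSupp U x₀ i y)

/-- The vectors differ outside `U`, on both disjoint supports and at `i`, that is, in at least `n -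
r + 1` coordinates. -/
lemma Opposite.lt_hammingDist (h : Opposite U x₀ i x y) (hi : i ∈ U) (hxy : x i ≠ y i)
    (hc : #(offSupp U x₀ i x) + #(offSupp U x₀ i y) + r = #U) : n < hammingDist x y + r := by
  have hU : #Uᶜ + #U = n := by
    have := card_compl_add_card U
    rwa [Fintype.card_fin] at this
  have h1 : #(Uᶜ ∪ insert i (offSupp U x₀ i x ∪ offSupp U x₀ i y)) =
      #Uᶜ + (#(offSupp U x₀ i x) + #(offSupp U x₀ i y) + 1) := by
    rw [card_union_of_disjoint, card_insert_of_notMem, card_union_of_disjoint h.2]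
    · simp [mem_offSupp]
    · rw [disjoint_left]
      intro j hj
      rw [mem_compl] at hj
      simp only [mem_insert, mem_union, mem_offSupp, not_or]
      exact ⟨fun e => hj (e ▸ hi), by tauto, by tauto⟩
  have h2 : Uᶜ ∪ insert i (offSupp U x₀ i x ∪ offSupp U x₀ i y) ⊆
      univ.filter fun j => x j ≠ y j := by
    intro j hj
    simp only [mem_union, mem_compl, mem_insert] at hj
    simp only [mem_filter, mem_univ, true_and]
    rcases hj with hj | rfl | hj | hj
    · exact h.1 j hj
    · exact hxy
    · have h3 := disjoint_left.1 h.2 hj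
      rw [mem_offSupp] at hj h3
      intro e
      exact h3 ⟨hj.1, e ▸ hj.2⟩
    · have h3 := disjoint_right.1 h.2 hj
      rw [mem_offSupp] at hj h3
      intro e
      exact h3 ⟨hj.1, e ▸ hj.2⟩
  have h3 := card_le_card h2
  unfold hammingDist
  omega

lemma Opposite.update (h : Opposite U x₀ i x y) (hi : i ∈ U) (a b : Fin (p i)) :
    Opposite U x₀ i (update x i a) (update y i b) := by
  refine ⟨fun j hj => ?_, by simpa using h.2⟩
  have : j ≠ i := fun e => hj (e ▸ hi)
  simpa [this] using h.1 j hj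

lemma Opposite.symm (h : Opposite U x₀ i x y) : Opposite U x₀ i y x :=
  ⟨fun j hj => (h.1 j hj).symm, h.2.symm⟩

/-- Outside `U`, three values per coordinate allow avoiding both `x` and `x'`. Inside `U`, the
support of `y` is chosen among the points left by their supports. -/
lemma exists_opposite (hp : ∀ i, 2 < p i) (x x' : Vec p)
    (hc : #(offSupp U x₀ i x ∪ offSupp U x₀ i x') + l ≤ #(U.erase i)) :
    ∃ y, #(offSupp U x₀ i y) = l ∧ Opposite U x₀ i x y ∧ Opposite U x₀ i x' y := by
  have hsub : offSupp U x₀ i x ∪ offSupp U x₀ i x' ⊆ U.erase i :=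
    union_subset (filter_subset _ _) (filter_subset _ _)
  obtain ⟨V, hV, hVc⟩ := exists_subset_card_eq
    (s := U.erase i \ (offSupp U x₀ i x ∪ offSupp U x₀ i x')) (n := l)
    (by rw [card_sdiff_of_subset hsub]; omega)
  obtain ⟨o, ho⟩ := exists_value_ne (p := p) (fun i => (hp i).le) x₀
  have hq : ∀ j, ∃ a : Fin (p j), a ≠ x j ∧ a ≠ x' j := fun j => by
    obtain ⟨a, -, ha⟩ := exists_mem_notMem_of_card_lt_card
      (s := ({x j, x' j} : Finset (Fin (p j)))) (t := univ) (by
        have := card_le_two (a := x j) (b := x' j)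
        have := hp j
        rw [card_fin]; omega)
    simp only [mem_insert, mem_singleton, not_or] at ha
    exact ⟨a, ha⟩
  choose q hq using hq
  have hVU : ∀ j ∈ V, j ≠ i ∧ j ∈ U := fun j hj => mem_erase.1 (mem_sdiff.1 (hV hj)).1
  have hs : offSupp U x₀ i (fun j => if j ∈ V then o j else if j ∈ U then x₀ j else q j) = V := by
    ext j
    rw [mem_offSupp]
    by_cases hj : j ∈ V
    · simp only [hj, if_true, iff_true]
      exact ⟨hVU j hj, ho j⟩
    · simp only [hj, if_false, iff_false]
      rintro ⟨h1, h2⟩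
      rw [if_pos h1.2] at h2
      exact h2 rfl
  have hout : ∀ j ∉ U, j ∉ V := fun j hj hjV => hj (hVU j hjV).2
  refine ⟨_, by rw [hs, hVc], ⟨fun j hj => ?_, ?_⟩, ⟨fun j hj => ?_, ?_⟩⟩
  · simp only [hout j hj, hj, if_false]
    exact (hq j).1.symm
  · rw [hs, disjoint_right]
    intro j hj
    have := (mem_sdiff.1 (hV hj)).2
    rw [mem_union, not_or] at this
    exact this.1
  · simp only [hout j hj, hj, if_false]
    exact (hq j).2.symm
  · rw [hs, disjoint_right]
    intro j hj
    have := (mem_sdiff.1 (hV hj)).2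
    rw [mem_union, not_or] at this
    exact this.2

/-- Two boundary vectors of `A`, one present at `c i` and the other at `v`, would have a common
opposite boundary vector `y`, and either position of `y` in `B` conflicts with one of them. So the
boundary of `A` uses a single value, and an opposite vector forces the same value on the boundary of
`B`. -/
lemma IsHammingPair.unshift_of_small (hp : ∀ i, 2 < p i) (hAB : CrossInt r A B) (hv : v ≠ c i)
    (h : IsHammingPair U x₀ r k l (shift c i v A) (shift c i v B))
    (hs : 2 * k + l + 1 ≤ #U) : ∃ x₁, IsHammingPair U x₁ r k l A B := by
  by_cases hU : i ∈ U ∧ x₀ i = c i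
  swap
  · have hA := shift_eq_self_of_hammingBall hv h.left hU
    have hB := shift_eq_self_of_hammingBall hv h.right hU
    rw [hA, hB] at h
    exact ⟨x₀, h⟩
  obtain ⟨hi, h0⟩ := hU
  have mA := mem_of_shift_eq_hammingBall hv h.left hi h0
  have mB := mem_of_shift_eq_hammingBall hv h.right hi h0
  have hc := h.card
  have hUe : #(U.erase i) + 1 = #U := card_erase_add_one hi
  have conflict : ∀ {x y : Vec p}, #(offSupp U x₀ i x) = k → #(offSupp U x₀ i y) = l →
      Opposite U x₀ i x y → ∀ a b, a ≠ b → update x i a ∈ A → update y i b ∈ B → False := by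
    intro x y hx hy ho a b hab hxA hyB
    have h1 := (ho.update hi a b).lt_hammingDist (r := r) hi (by simpa using hab) (by
      rw [offSupp_update, offSupp_update, hx, hy]; exact hc)
    have h2 := hAB _ hxA _ hyB
    rw [RIntersecting] at h2
    omega
  have orB : ∀ y, #(offSupp U x₀ i y) = l → update y i (c i) ∈ B ∨ update y i v ∈ B :=
    fun y hy => (mB y).1.1 hy.le
  have oppA : ∀ y, #(offSupp U x₀ i y) = l →
      ∃ x, #(offSupp U x₀ i x) = k ∧ Opposite U x₀ i x y := by
    intro y hy
    obtain ⟨x, hx, ho, -⟩ := exists_opposite (U := U) (x₀ := x₀) (i := i) (l := k) hp y y (by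
      rw [union_self, hy]; omega)
    exact ⟨x, hx, ho.symm⟩
  have same : ∀ x x', #(offSupp U x₀ i x) = k → #(offSupp U x₀ i x') = k →
      update x i (c i) ∈ A → update x' i v ∈ A → False := by
    intro x x' hx hx' hxA hxA'
    have := Finset.card_union_le (offSupp U x₀ i x) (offSupp U x₀ i x')
    obtain ⟨y, hy, ho, ho'⟩ := exists_opposite (U := U) (x₀ := x₀) (i := i) (l := l) hp x x'
      (by omega)
    rcases orB y hy with hyB | hyB
    · exact conflict hx' hy ho' _ _ hv hxA' hyB
    · exact conflict hx hy ho _ _ hv.symm hxA hyB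
  -- The common boundary value is either `c i`, keeping the centre, or `v`, moving the centre to `v`
  -- at `i`.
  by_cases hall : ∀ x, #(offSupp U x₀ i x) = k → update x i (c i) ∈ A
  · refine ⟨x₀, hc, eq_hammingBall_of_forall hv h.left hi h0 hall,
      eq_hammingBall_of_forall hv h.right hi h0 fun y hy => (orB y hy).resolve_right fun hyB => ?_⟩
    obtain ⟨x, hx, ho⟩ := oppA y hy
    exact conflict hx hy ho _ _ hv.symm (hall x hx) hyB
  · push Not at hall
    obtain ⟨x', hx', hxA'⟩ := hall
    have orA : ∀ x, #(offSupp U x₀ i x) = k → update x i (c i) ∈ A ∨ update x i v ∈ A :=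
      fun x hx => (mA x).1.1 hx.le
    have hall' : ∀ x, #(offSupp U x₀ i x) = k → update x i v ∈ A := fun x hx =>
      (orA x hx).resolve_left fun hxA => same x x' hx hx' hxA ((orA x' hx').resolve_left hxA')
    refine ⟨_, hc, eq_hammingBall_update_of_forall hv h.left hi h0 hall',
      eq_hammingBall_update_of_forall hv h.right hi h0
        fun y hy => (orB y hy).resolve_left fun hyB => ?_⟩
    obtain ⟨x, hx, ho⟩ := oppA y hy
    exact conflict hx hy ho _ _ hv (hall' x hx) hyB

/-- If shifting a cross-intersecting pair yields a suitable pair of balls, the pair itself is a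
pair of balls. -/
lemma IsHammingPair.unshift (hp : ∀ i, 2 < p i) (hAB : CrossInt r A B) (hv : v ≠ c i)
    (h : IsHammingPair U x₀ r k l (shift c i v A) (shift c i v B))
    (hs : Spread k l #U) : ∃ x₁, IsHammingPair U x₁ r k l A B := by
  rcases hs with hs | hs
  · exact h.unshift_of_small hp hAB hv hs.2
  · obtain ⟨x₁, h₁⟩ := h.symm.unshift_of_small hp hAB.symm hv hs.2
    exact ⟨x₁, h₁.symm⟩

end Unshift

/-! ### Induction on the potential, and the theorem. -/

section Main

variable {n : ℕ} {p : Fin n → ℕ} {A B : Finset (Vec p)} {r : ℕ}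

lemma exists_shift_ne {c : Vec p} (h : ¬ IsMono c A) :
    ∃ i v, v ≠ c i ∧ shift c i v A ≠ A := by
  by_contra hn
  push Not at hn
  exact h (isMono_of_shift_eq hn)

lemma exists_isMono_isMaximalPair (c : Vec p) {R : Finset (Fin n)} (m : ℕ) :
    ∀ A B : Finset (Vec p), potential c A = m → IsMaximalPair r A B →
      (∀ i ∉ R, Irrelevant A i ∧ Irrelevant B i) →
      ∃ A' B', IsMaximalPair r A' B' ∧ IsMono c A' ∧
        ∀ i ∉ R, Irrelevant A' i ∧ Irrelevant B' i := by
  induction m using Nat.strong_induction_on with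
  | _ m ih =>
    intro A B hm h hR
    by_cases hA : IsMono c A
    · exact ⟨A, B, h, hA, hR⟩
    · obtain ⟨i, v, hv, hne⟩ := exists_shift_ne hA
      exact ih _ (hm ▸ potential_shift_lt hv hne) _ _ rfl (h.shift hv)
        fun j hj => ⟨(hR j hj).1.shift hv, (hR j hj).2.shift hv⟩

/-- `U`, the radii and hence `Spread` survive undoing a shift; only the centre changes. So the
conclusion travels back from the monotone pair to the original one. -/
lemma IsMaximalPair.exists_isHammingPair (hp : ∀ i, 2 < p i) (hr1 : 1 ≤ r) (hr : r ≤ n)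
    (c : Vec p) {R : Finset (Fin n)} (hR : #R ≤ r + 3) (m : ℕ) :
    ∀ A B : Finset (Vec p), potential c A = m → IsMaximalPair r A B →
      (∀ i ∉ R, Irrelevant A i ∧ Irrelevant B i) →
      ∃ U x₀ k l, IsHammingPair U x₀ r k l A B ∧ Spread k l #U := by
  induction m using Nat.strong_induction_on with
  | _ m ih =>
    intro A B hm h hirr
    by_cases hA : IsMono c A
    · obtain ⟨U, k, l, hb, hs⟩ := h.exists_isHammingPair_of_isMono (P := Spread)
        (fun i => (hp i).le)
        (fun T 𝒜 ℬ ho hr' hd hf => ho.exists_isBallPair_spread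
          (fun i => by have := hp i; omega) hr1 hr' hd hf) hr hA hR hirr
      exact ⟨U, c, k, l, hb, hs⟩
    · obtain ⟨i, v, hv, hne⟩ := exists_shift_ne hA
      obtain ⟨U, x₀, k, l, hb, hs⟩ := ih _ (hm ▸ potential_shift_lt hv hne) _ _ rfl (h.shift hv)
        fun j hj => ⟨(hirr j hj).1.shift hv, (hirr j hj).2.shift hv⟩
      obtain ⟨x₁, h₁⟩ := hb.unshift hp h.1 hv hs
      exact ⟨U, x₁, k, l, h₁, hs⟩

lemma mem_relevantCoords {i : Fin n} :
    i ∈ relevantCoords A B ↔ ¬ (Irrelevant A i ∧ Irrelevant B i) := by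
  refine (@mem_filter _ _ (_) _ _).trans ?_
  simp only [mem_univ, true_and, Relevant, not_and_or]

lemma irrelevant_of_notMem_relevantCoords {i : Fin n} (h : i ∉ relevantCoords A B) :
    Irrelevant A i ∧ Irrelevant B i :=
  not_not.1 (mt mem_relevantCoords.2 h)

lemma relevantCoords_subset {R : Finset (Fin n)}
    (h : ∀ i ∉ R, Irrelevant A i ∧ Irrelevant B i) : relevantCoords A B ⊆ R := fun i hi => by
  by_contra hn
  exact mem_relevantCoords.1 hi (h i hn)

end Main

end CrossIntersecting

theorem theorem8 (n r : ℕ) (hr : 1 ≤ r) (hrn : r ≤ n) (p : Fin n → ℕ)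
    (hp : CrossIntersecting.IsSizeVector p) :
    ((∃ A B : Finset (CrossIntersecting.Vec p),
        CrossIntersecting.IsMaximalPair r A B ∧
          (CrossIntersecting.relevantCoords A B).card ≤ r + 2) →
      ∃ A B : Finset (CrossIntersecting.Vec p),
        CrossIntersecting.IsMaximalPair r A B ∧
          (CrossIntersecting.relevantCoords A B).card ≤ r + 2 ∧
          CrossIntersecting.IsBall A ∧ CrossIntersecting.IsBall B) ∧
    ((∀ i, 2 < p i) →
      ∀ A B : Finset (CrossIntersecting.Vec p),
        CrossIntersecting.IsMaximalPair r A B →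
          (CrossIntersecting.relevantCoords A B).card ≤ r + 3 →
            CrossIntersecting.IsBall A ∧ CrossIntersecting.IsBall B) := by
  open CrossIntersecting in
  have c : Vec p := fun i => ⟨0, by have := hp i; omega⟩
  refine ⟨?_, fun hp3 A B h hR => ?_⟩
  · rintro ⟨A, B, h, hR⟩
    obtain ⟨A', B', h', hA', hirr⟩ := exists_isMono_isMaximalPair c _ A B rfl h
      fun i => irrelevant_of_notMem_relevantCoords
    refine ⟨A', B', h', (Finset.card_le_card (relevantCoords_subset hirr)).trans hR, ?_⟩
    -- Only existence is claimed here, so no shift is undone and no condition on the radii is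
    -- needed.
    obtain ⟨U, k, l, hb, -⟩ := h'.exists_isHammingPair_of_isMono (P := fun _ _ _ => True) hp
      (fun T 𝒜 ℬ ho hr' hd _ => by
        obtain ⟨U, k, l, hb⟩ := ho.exists_isBallPair (fun i => by have := hp i; omega) hr' hd
        exact ⟨U, k, l, hb, trivial⟩) hrn hA' hR hirr
    exact hb.isBall
  · obtain ⟨U, x₀, k, l, hb, -⟩ := h.exists_isHammingPair hp3 hr hrn c hR _ A B rfl
      fun i => irrelevant_of_notMem_relevantCoords
    exact hb.isBall
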